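/- Let $N\ge 0$ and let $q_1,\dots,q_N$ be positive rational numbers. A polynomial $W\in\mathbb C[x_1,\dots,x_N]$ is \emph{admissible with weights} $q_1,\dots,q_N$ if every monomial $x_1^{a_1}\cdots x_N^{a_N}$ occurring in $W$ satisfies $\sum_j q_ja_j=1$, if $W$ has an isolated singularity at the origin (the origin is a critical point of $W$ and is isolated among the critical points), and if no monomial of the form $x_ix_j$ (including $i=j$) occurs in $W$. A subgroup $G\subset(\mathbb C^*)^N$ is \emph{admissible} for $W$ if $W(\beta_1x_1,\dots,\beta_Nx_N)=W(x_1,\dots,x_N)$ for all $\beta\in G$ and $J=(e^{2\pi i q_1},\dots,e^{2\pi i q_N})\in G$. Put $q=\sum_i q_i$. For $g=(e^{2\pi i\theta_1},\dots,e^{2\pi i\theta_N})\in G$ with $\theta_i\in[0,1)$ let $\operatorname{age}(g)=\sum_i\theta_i$, let $\operatorname{Fix}(g)\subset\mathbb C^N$ be the subspace fixed by $g$, $I_g=\{i\mid\theta_i=0\}$ and $N_g=\#I_g=\dim\operatorname{Fix}(g)$, let $W_g=W|_{\operatorname{Fix}(g)}$, and for $M>0$ let $W_g^\infty=(\operatorname{Re}W_g)^{-1}(M,\infty)\subset\operatorname{Fix}(g)$.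 The FJRW state space is $$\mathscr H_{W,G}=\bigoplus_{g\in G}\mathscr H_g,\qquad \mathscr H_g=\bigoplus_{n\ge0}H^n(\operatorname{Fix}(g),W_g^\infty;\mathbb C)^G ,$$ where $H^n$ is relative singular cohomology; a class in $H^n(\operatorname{Fix}(g),W_g^\infty;\mathbb C)^G$ has degree $n-2q+2\operatorname{age}(g)$. The cohomology groups vanish for $n\neq N_g$, and by a theorem of Wall there is an isomorphism of $G$-modules $$H^{N_g}(\operatorname{Fix}(g),W_g^\infty;\mathbb C)\;\cong\;\Omega^{N_g}/(dW_g\wedge\Omega^{N_g-1})\;\cong\;\mathscr Q_{W_g}\,d\mathbf x_{\operatorname{Fix}(g)},$$ where $\mathscr Q_{W_g}=\mathbb C[x_i: i\in I_g]/(\partial W_g/\partial x_i: i\in I_g)$ is the Milnor ring, $d\mathbf x_{\operatorname{Fix}(g)}$ is the standard volume form, and $G$ acts by pullback on both sides. Here $x_i$ is given degree $q_i$ and $d\mathbf x_{\operatorname{Fix}(g)}$ degree $\sum_{i\in I_g}q_i$. Through one such isomorphism for each $g$, the bigrading on $\mathscr H_{W,G}$ is defined by letting a class in $\mathscr H_g$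 that corresponds to a form of degree $p$ have bidegree $$(N_g-p-q+\operatorname{age}(g),\;p-q+\operatorname{age}(g)).$$ \textbf{Theorem.} As a bigraded vector space the state space depends only on the weights and on the action of $G$ on $\mathbb C^N$. That is, if $W$ and $W'$ are admissible with the same weights $q_1,\dots,q_N$, and $G\subset(\mathbb C^*)^N$ is admissible for both, then for any cut-offs $M,M'>0$ used for $W$ and $W'$ respectively: \begin{enumerate} \item there is a linear isomorphism $\mathscr H_{W,G}\to\mathscr H_{W',G}$ that maps $H^n(\operatorname{Fix}(g),W_g^\infty;\mathbb C)^G$ onto $H^n(\operatorname{Fix}(g),W_g'^\infty;\mathbb C)^G$ for all $g\in G$ and $n\ge0$, and maps $\mathscr H_{W,G}^{a,b}$ onto $\mathscr H_{W',G}^{a,b}$ for every bidegree $(a,b)$; \item likewise, for the model of the state space by forms, there is a linear isomorphism $\bigoplus_{g\in G}(\mathscr Q_{W_g}d\mathbf x_{\operatorname{Fix}(g)})^G\to\bigoplus_{g\in G}(\mathscr Q_{W'_g}d\mathbf x_{\operatorname{Fix}(g)})^G$ that maps the $g$-summand onto the $g$-summand for every $g\in G$ and preserves the bidegree. \end{enumerate}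 -/

import Mathlib

noncomputable section

set_option linter.unusedSectionVars false

namespace FJRW

open CategoryTheory MvPolynomial Topology

section Polynomials

variable {σ : Type} [Fintype σ]

/-- The singular (critical) points of `W`: the common zeros of its partial derivatives. -/
def IsSingularPoint (W : MvPolynomial σ ℂ) (x : σ → ℂ) : Prop :=
  ∀ i, eval x (pderiv i W) = 0

/-- `W` is nondegenerate: it has an isolated singularity at the origin. -/
def IsNondegenerate (W : MvPolynomial σ ℂ) : Prop :=
  IsSingularPoint W 0 ∧ ∀ᶠ x in 𝓝[≠] (0 : σ → ℂ), ¬ IsSingularPoint W x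

/-- `W` is an admissible quasihomogeneous polynomial with weights `q`. -/
structure IsAdmissible (q : σ → ℚ) (W : MvPolynomial σ ℂ) : Prop where
  /-- the weights are positive -/
  weight_pos : ∀ i, 0 < q i
  /-- every monomial of `W` has weighted degree one -/
  quasihomogeneous : IsWeightedHomogeneous q W 1
  /-- isolated singularity at the origin -/
  nondegenerate : IsNondegenerate W
  /-- no monomial of the form `x_i x_j` (including `i = j`) occurs in `W` -/
  no_quadratic : ∀ i j, coeff (Finsupp.single i 1 + Finsupp.single j 1) W = 0

/-- The maximal diagonal symmetry group `G_max ⊆ (ℂ^*)^N` of `W`. -/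
def maxSymmetryGroup (W : MvPolynomial σ ℂ) : Subgroup (σ → ℂˣ) where
  carrier := {β | ∀ x : σ → ℂ, eval (fun i => (β i : ℂ) * x i) W = eval x W}
  one_mem' := by intro x; simp
  mul_mem' := by
    intro a b ha hb x
    have h := ha (fun i => (b i : ℂ) * x i)
    rw [hb x] at h
    simpa [mul_assoc] using h
  inv_mem' := by
    intro a ha x
    have h := ha (fun i => ((a i)⁻¹ : ℂˣ) * x i)
    simpa using h.symm

/-- The grading element `J = (e^{2πi q_1}, …, e^{2πi q_N})`. -/
def gradingElement (q : σ → ℚ) : σ → ℂˣ :=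
  fun i => Units.mk0 (Complex.exp (2 * Real.pi * Complex.I * (q i : ℂ))) (Complex.exp_ne_zero _)

/-- `G` is an admissible group for `W`: a subgroup of `G_max` that contains `J`. -/
structure IsAdmissibleGroup (q : σ → ℚ) (W : MvPolynomial σ ℂ) (G : Subgroup (σ → ℂˣ)) : Prop where
  le_max : G ≤ maxSymmetryGroup W
  grading_mem : gradingElement q ∈ G

/-- The phase `θ ∈ [0, 1)` of a complex number `z = e^{2πiθ}` of modulus one. -/
def phase (z : ℂˣ) : ℝ := Int.fract (Complex.arg (z : ℂ) / (2 * Real.pi))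

/-- The age of a diagonal symmetry: the sum of its phases. -/
def age (g : σ → ℂˣ) : ℝ := ∑ i, phase (g i)

/-- `q = q_1 + ⋯ + q_N`, the age of the grading element. -/
def totalWeight (q : σ → ℚ) : ℝ := ∑ i, (q i : ℝ)

end Polynomials

section FixedLoci

variable {σ : Type}

/-- The set of fixed indices `I_g`, as a type. The fixed space `Fix(g)` is identified with the
coordinate space `FixedIndex g → ℂ`. -/
abbrev FixedIndex (g : σ → ℂˣ) : Type := {i : σ // g i = 1}

instance [Fintype σ] (g : σ → ℂˣ) : Fintype (FixedIndex g) := Fintype.ofFinite _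

/-- `N_g`, the dimension of `Fix(g)`. -/
def fixedDim (g : σ → ℂˣ) : ℕ := Nat.card (FixedIndex g)

open Classical in
/-- The inclusion of `Fix(g)`, in its coordinates, into the whole space. -/
def fixedInclusion (g : σ → ℂˣ) (x : FixedIndex g → ℂ) : σ → ℂ :=
  fun i => if h : g i = 1 then x ⟨i, h⟩ else 0

open Classical in
/-- `W_g`, the restriction of `W` to `Fix(g)`, a polynomial in the variables `x_i`, `i ∈ I_g`. -/
def restrictToFixed (W : MvPolynomial σ ℂ) (g : σ → ℂˣ) : MvPolynomial (FixedIndex g) ℂ :=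
  aeval (fun i => if h : g i = 1 then (X ⟨i, h⟩ : MvPolynomial (FixedIndex g) ℂ) else 0) W

/-- The action of a diagonal matrix on `Fix(g)`, in coordinates. -/
def restrictTorus (g h : σ → ℂˣ) : FixedIndex g → ℂˣ := fun i => h i.1

theorem range_fixedInclusion (g : σ → ℂˣ) :
    Set.range (fixedInclusion g) = {a : σ → ℂ | (fun i => (g i : ℂ) * a i) = a} := by
  ext a
  constructor
  · rintro ⟨x, rfl⟩
    funext i
    by_cases h : g i = 1 <;> simp [fixedInclusion, h]
  · intro ha
    refine ⟨fun i => a i.1, ?_⟩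
    funext i
    by_cases h : g i = 1
    · simp [fixedInclusion, h]
    · have hi : (g i : ℂ) * a i = a i := congrFun ha i
      have h1 : (g i : ℂ) ≠ 1 := fun h' => h (Units.ext h')
      have h2 : ((g i : ℂ) - 1) * a i = 0 := by rw [sub_mul, hi]; ring
      have h3 : a i = 0 := by
        rcases mul_eq_zero.1 h2 with h4 | h4
        · exact absurd (sub_eq_zero.1 h4) h1
        · exact h4
      simp [fixedInclusion, h, h3]

theorem eval_restrictToFixed (W : MvPolynomial σ ℂ) (g : σ → ℂˣ) (x : FixedIndex g → ℂ) :
    eval x (restrictToFixed W g) = eval (fixedInclusion g x) W := by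
  have h : (eval x).comp (aeval (R := ℂ) (fun i => if h : g i = 1 then
      (X ⟨i, h⟩ : MvPolynomial (FixedIndex g) ℂ) else 0)).toRingHom = eval (fixedInclusion g x) := by
    refine MvPolynomial.ringHom_ext ?_ ?_
    · intro r; simp
    · intro i
      by_cases h : g i = 1 <;> simp [fixedInclusion, h]
  exact congrArg (fun φ => φ W) h

theorem restrictTorus_mem [Fintype σ] {W : MvPolynomial σ ℂ} (g : σ → ℂˣ) {h : σ → ℂˣ}
    (hW : h ∈ maxSymmetryGroup W) :
    restrictTorus g h ∈ maxSymmetryGroup (restrictToFixed W g) := by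
  intro x
  rw [eval_restrictToFixed, eval_restrictToFixed, ← hW (fixedInclusion g x)]
  congr 2
  funext i
  by_cases hi : g i = 1 <;> simp [fixedInclusion, restrictTorus, hi]

end FixedLoci

section RelativeCohomology

/-- Singular chains with complex coefficients. -/
abbrev singularChains : TopCat.{0} ⥤ ChainComplex (ModuleCat.{0} ℂ) ℕ :=
  (AlgebraicTopology.singularChainComplexFunctor (ModuleCat.{0} ℂ)).obj (ModuleCat.of ℂ ℂ)

/-- The inclusion of a subspace. -/
def inclusionMap (X : Type) [TopologicalSpace X] (A : Set X) : TopCat.of A ⟶ TopCat.of X :=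
  TopCat.ofHom ⟨Subtype.val, continuous_subtype_val⟩

/-- The relative singular chains `S(X, A) = S(X) / S(A)`. -/
def relativeChains (X : Type) [TopologicalSpace X] (A : Set X) :
    ChainComplex (ModuleCat.{0} ℂ) ℕ :=
  Limits.cokernel (singularChains.map (inclusionMap X A))

/-- The chain map that a continuous map of pairs `(X, A) → (Y, B)` induces. -/
def relativeChainsMap {X Y : Type} [TopologicalSpace X] [TopologicalSpace Y] {A : Set X}
    {B : Set Y} (f : C(X, Y)) (hf : Set.MapsTo f A B) :
    relativeChains X A ⟶ relativeChains Y B :=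
  Limits.cokernel.map _ _
    (singularChains.map (TopCat.ofHom
      ⟨hf.restrict f A B, f.continuous.restrict hf⟩ : TopCat.of A ⟶ TopCat.of B))
    (singularChains.map (TopCat.ofHom f : TopCat.of X ⟶ TopCat.of Y))
    (by rw [← Functor.map_comp, ← Functor.map_comp]; rfl)

variable (K L : ChainComplex (ModuleCat.{0} ℂ) ℕ) (n : ℕ)

/-- The cocycles of degree `n` in the dual complex `Hom(K, ℂ)`. -/
def cocycles : Submodule ℂ (Module.Dual ℂ (K.X n)) :=
  LinearMap.ker (K.d (n + 1) n).hom.dualMap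

/-- The coboundaries of degree `n` in the dual complex `Hom(K, ℂ)`; for `n = 0` the differential
in question is zero. -/
def coboundaries : Submodule ℂ (Module.Dual ℂ (K.X n)) :=
  LinearMap.range (K.d n ((ComplexShape.down ℕ).next n)).hom.dualMap

/-- The cohomology in degree `n` of the dual complex `Hom(K, ℂ)`. -/
abbrev DualCohomology : Type := cocycles K n ⧸ (coboundaries K n).submoduleOf (cocycles K n)

variable {K L}

theorem dualMap_mem_cocycles (φ : K ⟶ L) (c : Module.Dual ℂ (L.X n)) (hc : c ∈ cocycles L n) :
    (φ.f n).hom.dualMap c ∈ cocycles K n := by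
  have hc' : c.comp (L.d (n + 1) n).hom = 0 := hc
  have h := congrArg ModuleCat.Hom.hom (φ.comm (n + 1) n)
  rw [ModuleCat.hom_comp, ModuleCat.hom_comp] at h
  change (c.comp (φ.f n).hom).comp (K.d (n + 1) n).hom = 0
  rw [LinearMap.comp_assoc, ← h, ← LinearMap.comp_assoc, hc', LinearMap.zero_comp]

theorem dualMap_mem_coboundaries (φ : K ⟶ L) (c : Module.Dual ℂ (L.X n))
    (hc : c ∈ coboundaries L n) : (φ.f n).hom.dualMap c ∈ coboundaries K n := by
  obtain ⟨b, rfl⟩ := hc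
  refine ⟨(φ.f ((ComplexShape.down ℕ).next n)).hom.dualMap b, ?_⟩
  have h := congrArg ModuleCat.Hom.hom (φ.comm n ((ComplexShape.down ℕ).next n))
  rw [ModuleCat.hom_comp, ModuleCat.hom_comp] at h
  exact congrArg (fun l => b.comp l) h.symm

/-- The pullback in cohomology along a chain map. -/
def dualCohomologyMap (φ : K ⟶ L) : DualCohomology L n →ₗ[ℂ] DualCohomology K n :=
  Submodule.mapQ _ _
    ((φ.f n).hom.dualMap.restrict (p := cocycles L n) (q := cocycles K n)
      (dualMap_mem_cocycles n φ))
    (fun c hc => dualMap_mem_coboundaries n φ c.1 hc)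

end RelativeCohomology

section Sectors

variable {σ : Type} [Fintype σ]

/-- `V^∞ = (Re V)⁻¹(M, ∞)`. -/
def upperSet (V : MvPolynomial σ ℂ) (M : ℝ) : Set (σ → ℂ) := {x | M < (eval x V).re}

/-- The relative singular cohomology `H^n(ℂ^σ, V^∞; ℂ)`. -/
abbrev RelCohomology (V : MvPolynomial σ ℂ) (M : ℝ) (n : ℕ) : Type :=
  DualCohomology (relativeChains (σ → ℂ) (upperSet V M)) n

/-- A diagonal matrix, as a continuous self-map of `ℂ^σ`. -/
def torusMap (h : σ → ℂˣ) : C(σ → ℂ, σ → ℂ) :=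
  ⟨fun x i => (h i : ℂ) * x i, by fun_prop⟩

theorem torusMap_mapsTo (V : MvPolynomial σ ℂ) (M : ℝ) (h : maxSymmetryGroup V) :
    Set.MapsTo (torusMap h.1) (upperSet V M) (upperSet V M) := by
  intro x hx
  have := h.2 x
  simpa [upperSet, torusMap, this] using hx

/-- The action of a diagonal symmetry of `V` on `H^n(ℂ^σ, V^∞; ℂ)` by pullback. -/
def cohomologyPullback (V : MvPolynomial σ ℂ) (M : ℝ) (n : ℕ) (h : maxSymmetryGroup V) :
    RelCohomology V M n →ₗ[ℂ] RelCohomology V M n :=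
  dualCohomologyMap n (relativeChainsMap (torusMap h.1) (torusMap_mapsTo V M h))

/-- The Jacobian ideal of `V`, generated by the partial derivatives. -/
def jacobianIdeal (V : MvPolynomial σ ℂ) : Ideal (MvPolynomial σ ℂ) :=
  Ideal.span (Set.range fun i => pderiv i V)

/-- The space of top-degree forms `Ω / (dV ∧ Ω) = 𝒬_V · d𝐱`, where `𝒬_V` is the Milnor ring of
`V`; the class of the polynomial `P` stands for the form `P d𝐱`. -/
abbrev MilnorForms (V : MvPolynomial σ ℂ) : Type :=
  MvPolynomial σ ℂ ⧸ (jacobianIdeal V).restrictScalars ℂ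

/-- The substitution `x_i ↦ h_i x_i` in polynomials. -/
def substTorus (h : σ → ℂˣ) : MvPolynomial σ ℂ →ₐ[ℂ] MvPolynomial σ ℂ :=
  aeval fun i => C (h i : ℂ) * X i

/-- The pullback of the form `P d𝐱` along a diagonal matrix `h`: its coefficient is
`(∏ h_i) P(h x)`. -/
def formPullbackPoly (h : σ → ℂˣ) : MvPolynomial σ ℂ →ₗ[ℂ] MvPolynomial σ ℂ :=
  (∏ i, (h i : ℂ)) • (substTorus h).toLinearMap

theorem substTorus_eq {V : MvPolynomial σ ℂ} (h : maxSymmetryGroup V) :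
    substTorus h.1 V = V := by
  apply MvPolynomial.funext
  intro x
  rw [← h.2 x]
  have h' : (eval x).comp (substTorus h.1).toRingHom = eval (fun i => (h.1 i : ℂ) * x i) := by
    refine MvPolynomial.ringHom_ext ?_ ?_
    · intro r; simp [substTorus]
    · intro i; simp [substTorus]
  exact congrArg (fun φ => φ V) h'

theorem pderiv_substTorus (h : σ → ℂˣ) (i : σ) (P : MvPolynomial σ ℂ) :
    pderiv i (substTorus h P) = C (h i : ℂ) * substTorus h (pderiv i P) := by
  classical
  induction P using MvPolynomial.induction_on with
  | C a => simp [substTorus]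
  | add p r hp hr => simp only [map_add, hp, hr, mul_add]
  | mul_X p j hp =>
    have hX : substTorus h (X j) = C (h j : ℂ) * X j := by simp [substTorus]
    rw [map_mul, Derivation.leibniz, Derivation.leibniz, hp, hX, Derivation.leibniz, pderiv_C,
      pderiv_X, map_add, smul_eq_mul, smul_eq_mul, smul_eq_mul, smul_eq_mul, smul_eq_mul,
      smul_eq_mul, map_mul, map_mul, hX]
    by_cases hij : j = i
    · subst hij; simp; ring
    · simp [hij]; ring

theorem formPullbackPoly_mem {V : MvPolynomial σ ℂ} (h : maxSymmetryGroup V)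
    (P : MvPolynomial σ ℂ) (hP : P ∈ jacobianIdeal V) :
    formPullbackPoly h.1 P ∈ jacobianIdeal V := by
  have hle : jacobianIdeal V ≤ (jacobianIdeal V).comap (substTorus h.1) := by
    refine Ideal.span_le.2 ?_
    rintro _ ⟨i, rfl⟩
    have h1 := pderiv_substTorus h.1 i V
    rw [substTorus_eq h] at h1
    have h2 : substTorus h.1 (pderiv i V) = C ((h.1 i : ℂ)⁻¹) * pderiv i V := by
      conv_rhs => rw [h1]
      rw [← mul_assoc, ← C_mul, inv_mul_cancel₀ (Units.ne_zero _), C_1, one_mul]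
    change substTorus h.1 (pderiv i V) ∈ jacobianIdeal V
    rw [h2]
    exact Ideal.mul_mem_left _ _ (Ideal.subset_span ⟨i, rfl⟩)
  have h3 : formPullbackPoly h.1 P = C (∏ i, (h.1 i : ℂ)) * substTorus h.1 P := by
    simp [formPullbackPoly, MvPolynomial.smul_eq_C_mul]
  rw [h3]
  exact Ideal.mul_mem_left _ _ (hle hP)

/-- The action of a diagonal symmetry of `V` on `Ω / (dV ∧ Ω)` by pullback of forms. -/
def formPullback (V : MvPolynomial σ ℂ) (h : maxSymmetryGroup V) :
    MilnorForms V →ₗ[ℂ] MilnorForms V :=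
  Submodule.mapQ _ _ (formPullbackPoly h.1) (fun P hP => formPullbackPoly_mem h P hP)

/-- The forms of degree `p` in `𝒬_V · d𝐱`, where `x_i` has degree `w i` and `d𝐱` has degree
`∑ w i`. -/
def formsOfDegree (w : σ → ℚ) (V : MvPolynomial σ ℂ) (p : ℝ) : Submodule ℂ (MilnorForms V) :=
  Submodule.map (Submodule.mkQ _)
    (weightedHomogeneousSubmodule ℂ (fun i => (w i : ℝ)) (p - ∑ i, (w i : ℝ)))

end Sectors

section StateSpace

variable {σ : Type} [Fintype σ]

/-- The symmetry of `W_g` that a symmetry `h` of `W` induces on `Fix(g)`. -/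
def inducedSymmetry {W : MvPolynomial σ ℂ} (g : σ → ℂˣ) (h : maxSymmetryGroup W) :
    maxSymmetryGroup (restrictToFixed W g) :=
  ⟨restrictTorus g h.1, restrictTorus_mem g h.2⟩

/-- `H^n(Fix(g), W_g^∞; ℂ)^G`, the part of cohomological degree `n` of the `g`-sector. The group
`G` is meant to lie in `G_max`. -/
def sectorCohomology (W : MvPolynomial σ ℂ) (G : Subgroup (σ → ℂˣ)) (M : ℝ) (g : σ → ℂˣ) (n : ℕ) :
    Submodule ℂ (RelCohomology (restrictToFixed W g) M n) where
  carrier := {c | ∀ h : maxSymmetryGroup W, h.1 ∈ G →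
    cohomologyPullback (restrictToFixed W g) M n (inducedSymmetry g h) c = c}
  zero_mem' := by intro h _; exact map_zero _
  add_mem' := by intro a b ha hb h hG; rw [map_add, ha h hG, hb h hG]
  smul_mem' := by intro r a ha h hG; rw [map_smul, ha h hG]

/-- `(Ω / (dW_g ∧ Ω))^G`, the `G`-invariant part of `𝒬_{W_g} · d𝐱_{Fix(g)}`. -/
def sectorForms (W : MvPolynomial σ ℂ) (G : Subgroup (σ → ℂˣ)) (g : σ → ℂˣ) :
    Submodule ℂ (MilnorForms (restrictToFixed W g)) where
  carrier := {c | ∀ h : maxSymmetryGroup W, h.1 ∈ G →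
    formPullback (restrictToFixed W g) (inducedSymmetry g h) c = c}
  zero_mem' := by intro h _; exact map_zero _
  add_mem' := by intro a b ha hb h hG; rw [map_add, ha h hG, hb h hG]
  smul_mem' := by intro r a ha h hG; rw [map_smul, ha h hG]

/-- The FJRW state space: the direct sum over `g ∈ G` and over the cohomological degree `n` of
`H^n(Fix(g), W_g^∞; ℂ)^G`. -/
abbrev StateSpace (W : MvPolynomial σ ℂ) (G : Subgroup (σ → ℂˣ)) (M : ℝ) : Type :=
  DirectSum (G × ℕ) fun i => sectorCohomology W G M i.1 i.2

/-- The model of the state space by forms: the direct sum over `g ∈ G` of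
`(𝒬_{W_g} · d𝐱_{Fix(g)})^G`. -/
abbrev FormStateSpace (W : MvPolynomial σ ℂ) (G : Subgroup (σ → ℂˣ)) : Type :=
  DirectSum G fun g => sectorForms W G g

/-- A Wall isomorphism for the `g`-sector: an isomorphism of `G`-modules from
`H^{N_g}(Fix(g), W_g^∞; ℂ)` to `Ω^{N_g} / (dW_g ∧ Ω^{N_g - 1})`. -/
structure WallIsomorphism (W : MvPolynomial σ ℂ) (G : Subgroup (σ → ℂˣ)) (M : ℝ) (g : σ → ℂˣ) where
  toEquiv : RelCohomology (restrictToFixed W g) M (fixedDim g) ≃ₗ[ℂ]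
    MilnorForms (restrictToFixed W g)
  equivariant : ∀ h : maxSymmetryGroup W, h.1 ∈ G → ∀ c,
    toEquiv (cohomologyPullback (restrictToFixed W g) M (fixedDim g) (inducedSymmetry g h) c) =
      formPullback (restrictToFixed W g) (inducedSymmetry g h) (toEquiv c)

/-- The degree of a form on `Fix(g)` in terms of the weights of the fixed variables. -/
def sectorFormsOfDegree (q : σ → ℚ) (W : MvPolynomial σ ℂ) (g : σ → ℂˣ) (p : ℝ) :
    Submodule ℂ (MilnorForms (restrictToFixed W g)) :=
  formsOfDegree (fun i : FixedIndex g => q i.1) (restrictToFixed W g) p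

open Classical in
/-- The piece `H^{N_g - p, p}(Fix(g), W_g^∞; ℂ)^G` of the `g`-sector: the classes that a Wall
isomorphism takes to forms of degree `p`. A Wall isomorphism exists for every admissible `W` and
`G` (a theorem of Wall); another choice of it gives an isomorphic bigraded vector space. The value
`⊥` is only there to make the definition total. -/
def hodgePiece (q : σ → ℚ) (W : MvPolynomial σ ℂ) (G : Subgroup (σ → ℂˣ)) (M : ℝ) (g : σ → ℂˣ)
    (p : ℝ) : Submodule ℂ (sectorCohomology W G M g (fixedDim g)) :=
  if hw : Nonempty (WallIsomorphism W G M g) then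
    (sectorFormsOfDegree q W g p).comap
      ((Classical.choice hw).toEquiv.toLinearMap.comp (Submodule.subtype _))
  else ⊥

open Classical in
/-- The inclusion of `H^n(Fix(g), W_g^∞; ℂ)^G` into the state space. -/
def sectorInclusion (W : MvPolynomial σ ℂ) (G : Subgroup (σ → ℂˣ)) (M : ℝ) (g : G) (n : ℕ) :
    sectorCohomology W G M g n →ₗ[ℂ] StateSpace W G M :=
  DirectSum.lof ℂ (G × ℕ) (fun i => sectorCohomology W G M i.1 i.2) (g, n)

open Classical in
/-- The inclusion of the `g`-sector into the model of the state space by forms. -/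
def formSectorInclusion (W : MvPolynomial σ ℂ) (G : Subgroup (σ → ℂˣ)) (g : G) :
    sectorForms W G g →ₗ[ℂ] FormStateSpace W G :=
  DirectSum.lof ℂ G (fun g => sectorForms W G g) g

/-- `deg_+ = N_g - p - q + age(g)` on classes of type `(N_g - p, p)` in the `g`-sector. -/
def degPlus (q : σ → ℚ) (g : σ → ℂˣ) (p : ℝ) : ℝ := fixedDim g - p - totalWeight q + age g

/-- `deg_- = p - q + age(g)` on classes of type `(N_g - p, p)` in the `g`-sector. -/
def degMinus (q : σ → ℚ) (g : σ → ℂˣ) (p : ℝ) : ℝ := p - totalWeight q + age g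

/-- The subspace of bidegree `(a, b)` of the state space. -/
def bigradedPiece (q : σ → ℚ) (W : MvPolynomial σ ℂ) (G : Subgroup (σ → ℂˣ)) (M : ℝ) (a b : ℝ) :
    Submodule ℂ (StateSpace W G M) :=
  ⨆ (g : G) (p : ℝ) (_ : degPlus q g.1 p = a ∧ degMinus q g.1 p = b),
    (hodgePiece q W G M g p).map (sectorInclusion W G M g (fixedDim g.1))

/-- The subspace of bidegree `(a, b)` of the model of the state space by forms. -/
def formBigradedPiece (q : σ → ℚ) (W : MvPolynomial σ ℂ) (G : Subgroup (σ → ℂˣ)) (a b : ℝ) :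
    Submodule ℂ (FormStateSpace W G) :=
  ⨆ (g : G) (p : ℝ) (_ : degPlus q g.1 p = a ∧ degMinus q g.1 p = b),
    ((sectorFormsOfDegree q W g p).comap (Submodule.subtype _)).map (formSectorInclusion W G g)

end StateSpace

end FJRW

end

/-!
In a fixed sector the state space is the cohomology of the pair `(Fix(g), W_g^∞)`, and the bigrading
is that of the Milnor ring of `W_g`. The restrictions `W_g` and `W'_g` are weighted homogeneous of
degree one, have an isolated critical point (`IsAdmissible.isSingularPoint_restrictToFixed_iff`), and
are invariant under the unitary diagonal group `G` (`IsAdmissible.norm_eq_one`). The theorem follows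
from two facts about a pair `V`, `V'` of such polynomials.

*Topology* (`equivariantlyEquivalent_upperSet_of_isolated`). The cohomologies of the pairs of `V`
and `V'` are isomorphic representations of `G`. On the complex line `V + t (V' - V)` all but finitely
many members have an isolated critical point (`finite_not_isolated`), so `V` and `V'` are joined
through such polynomials. Nearby members of the line have equivalent pairs
(`exists_equivariantlyEquivalent_perturbation`): a short straight push along the conjugate gradient
of `V`, rescaled so as to commute with the weighted scaling, raises the real part of every
nearby polynomial, hence maps the upper set of each into that of the other. No flow has to be
integrated. The scaling changes the cut-offs.

*Algebra* (`exists_milnorForms_equiv`). The Milnor rings are isomorphic as graded representations of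
`G`. Polynomials are graded by the weight together with the characters of the elements of `G`, and
in this grading `∂_i V` and `∂_i V'` are homogeneous of the same degree. By the Nullstellensatz the
Jacobian ideal contains powers `x_i ^ n`, which form a regular sequence; a comparison of Koszul
complexes (`exists_koszul_syzygy`) shows that the derivatives have only the obvious relations, so they
form a regular sequence, and the dimensions of the graded pieces of the Jacobian ideal are determined
by the degrees alone (`finrank_gradedPiece_eq`). Ideals with graded pieces of equal dimensions
correspond under a graded linear automorphism of the polynomial ring
(`exists_graded_linearEquiv`), which commutes with `G` since the degree records the characters.

Composing with these isomorphisms carries a Wall isomorphism for `W` to one for `W'`. In the middle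
degree the isomorphism of state spaces is the one of Milnor rings read through the two Wall
isomorphisms in use, which respects the bigrading (`exists_hodgePiece_equiv`); in the other degrees it
is the one from the deformation.
-/

noncomputable section

set_option linter.unusedSectionVars false

/-! ### Naturality of the homotopy invariance of relative cohomology -/

section

open CategoryTheory Limits MonoidalCategory Simplicial Opposite

namespace FJRW

/-- A map that commutes with two homotopies `A ⊗ Δ[1] ⟶ B`, `X ⊗ Δ[1] ⟶ Y` commutes with the
operators `h k` of the associated combinatorial homotopies. -/
theorem simplicialHomotopy_naturality {A B X Y : SSet.{0}} {f g : A ⟶ B}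
    {f' g' : X ⟶ Y} (HA : SSet.Homotopy f g) (HX : SSet.Homotopy f' g') (i : A ⟶ X) (j : B ⟶ Y)
    (h : i ▷ Δ[1] ≫ HX.h = HA.h ≫ j) {n : ℕ} (k : Fin (n + 1)) :
    i.app (op ⦋n⦌) ≫ HX.toSimplicialObjectHomotopy.h k =
      HA.toSimplicialObjectHomotopy.h k ≫ j.app (op ⦋n + 1⦌) := by
  ext x
  simp only [SSet.Homotopy.toSimplicialObjectHomotopy]
  change (SSet.yonedaEquiv.symm (i.app (op ⦋n⦌) x) ▷ Δ[1] ≫ HX.h).app _ _ =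
    j.app _ ((SSet.yonedaEquiv.symm x ▷ Δ[1] ≫ HA.h).app _ _)
  rw [← SSet.yonedaEquiv_symm_comp, comp_whiskerRight, Category.assoc, h]
  rfl

theorem toSSet_homotopy_naturality {A B X Y : TopCat.{0}} {f g : A ⟶ B}
    {f' g' : X ⟶ Y} (HA : TopCat.Homotopy f g) (HX : TopCat.Homotopy f' g') (i : A ⟶ X) (j : B ⟶ Y)
    (h : ∀ t a, HX (t, i a) = j (HA (t, a))) :
    TopCat.toSSet.map i ▷ Δ[1] ≫ HX.toSSet.h = HA.toSSet.h ≫ TopCat.toSSet.map j := by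
  have h1 : i ▷ TopCat.I ≫ HX.h = HA.h ≫ j := by
    ext p
    exact h _ _
  simp only [TopCat.Homotopy.toSSet, Category.assoc]
  rw [← Functor.map_comp, ← h1, Functor.map_comp, ← whisker_exchange_assoc,
    Functor.LaxMonoidal.μ_natural_left_assoc]

theorem comp_neg_sum_zsmul {C : Type*} [Category C] [Preadditive C] {a b c d : C} {κ : Type*}
    [Fintype κ] (f : a ⟶ b) (g : κ → (b ⟶ d)) (g' : κ → (a ⟶ c)) (f' : c ⟶ d) (e : κ → ℤ)
    (h : ∀ k, f ≫ g k = g' k ≫ f') : f ≫ (-∑ k, e k • g k) = (-∑ k, e k • g' k) ≫ f' := by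
  simp only [Preadditive.comp_neg, Preadditive.neg_comp, Preadditive.comp_sum,
    Preadditive.sum_comp, Preadditive.comp_zsmul, Preadditive.zsmul_comp, h]

/-- The prism operators on singular chains are natural: a homotopy `HX` that extends the homotopy
`HA` along `i` and `j` induces a chain homotopy that extends the one of `HA`. -/
theorem chainHomotopy_naturality {A B X Y : TopCat.{0}} {f g : A ⟶ B}
    {f' g' : X ⟶ Y} (HA : TopCat.Homotopy f g) (HX : TopCat.Homotopy f' g') (i : A ⟶ X) (j : B ⟶ Y)
    (h : ∀ t a, HX (t, i a) = j (HA (t, a))) (p q : ℕ) :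
    (singularChains.map i).f p ≫
      (HX.singularChainComplexFunctorObjMap (ModuleCat.of ℂ ℂ)).hom p q =
    (HA.singularChainComplexFunctorObjMap (ModuleCat.of ℂ ℂ)).hom p q ≫
      (singularChains.map j).f q := by
  by_cases hpq : p + 1 = q
  · subst hpq
    have key := fun k : Fin (p + 1) => congrArg (sigmaConst.obj (ModuleCat.of ℂ ℂ)).map
      (simplicialHomotopy_naturality HA.toSSet HX.toSSet _ _
      (toSSet_homotopy_naturality HA HX i j h) k)
    simp only [Functor.map_comp] at key
    change (sigmaConst.obj (ModuleCat.of ℂ ℂ)).map ((TopCat.toSSet.map i).app (op ⦋p⦌)) ≫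
      SimplicialObject.Homotopy.ToChainHomotopy.hom
        (HX.toSSet.toSimplicialObjectHomotopy.whiskerRight (sigmaConst.obj (ModuleCat.of ℂ ℂ)))
          p (p + 1) =
      SimplicialObject.Homotopy.ToChainHomotopy.hom
        (HA.toSSet.toSimplicialObjectHomotopy.whiskerRight (sigmaConst.obj (ModuleCat.of ℂ ℂ)))
          p (p + 1) ≫
      (sigmaConst.obj (ModuleCat.of ℂ ℂ)).map ((TopCat.toSSet.map j).app (op ⦋p + 1⦌))
    rw [SimplicialObject.Homotopy.ToChainHomotopy.hom_eq,
      SimplicialObject.Homotopy.ToChainHomotopy.hom_eq]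
    exact comp_neg_sum_zsmul _ _ _ _ _ key
  · rw [Homotopy.zero _ _ _ hpq, Homotopy.zero _ _ _ hpq]; simp

/-- The projection `S(X) → S(X, A)` onto the relative chains. -/
def relativeChainsπ (X : Type) [TopologicalSpace X] (A : Set X) :
    singularChains.obj (TopCat.of X) ⟶ relativeChains X A :=
  cokernel.π (singularChains.map (inclusionMap X A))

theorem relativeChains_hom_ext {X : Type} [TopologicalSpace X] {A : Set X}
    {T : ChainComplex (ModuleCat.{0} ℂ) ℕ} {f g : relativeChains X A ⟶ T}
    (h : relativeChainsπ X A ≫ f = relativeChainsπ X A ≫ g) : f = g :=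
  coequalizer.hom_ext h

theorem relativeChainsπ_map {X Y : Type} [TopologicalSpace X] [TopologicalSpace Y] {A : Set X}
    {B : Set Y} (f : C(X, Y)) (hf : Set.MapsTo f A B) :
    relativeChainsπ X A ≫ relativeChainsMap f hf =
      singularChains.map (TopCat.ofHom f) ≫ relativeChainsπ Y B :=
  cokernel.π_desc _ _ _

theorem inclusion_comp_relativeChainsπ (X : Type) [TopologicalSpace X] (A : Set X) :
    singularChains.map (inclusionMap X A) ≫ relativeChainsπ X A = 0 :=
  cokernel.condition _

/-- A cochain of `X` that vanishes on the chains in `A` is a relative cochain, since cokernels of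
chain maps are formed degreewise. -/
theorem exists_relativeChainsπ_comp {X : Type} [TopologicalSpace X] {A : Set X} {n : ℕ}
    {T : ModuleCat.{0} ℂ} (b : (singularChains.obj (TopCat.of X)).X n ⟶ T)
    (hb : (singularChains.map (inclusionMap X A)).f n ≫ b = 0) :
    ∃ c : (relativeChains X A).X n ⟶ T, (relativeChainsπ X A).f n ≫ c = b := by
  let F := HomologicalComplex.eval (ModuleCat.{0} ℂ) (ComplexShape.down ℕ) n
  have hcolim := isColimitOfHasCokernelOfPreservesColimit F (singularChains.map (inclusionMap X A))
  exact ⟨hcolim.desc (CokernelCofork.ofπ b hb), hcolim.fac _ WalkingParallelPair.one⟩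

instance epi_relativeChainsπ_f {X : Type} [TopologicalSpace X] {A : Set X} {n : ℕ} :
    Epi ((relativeChainsπ X A).f n) :=
  inferInstanceAs (Epi ((HomologicalComplex.eval (ModuleCat.{0} ℂ) (ComplexShape.down ℕ) n).map
    (cokernel.π (singularChains.map (inclusionMap X A)))))

theorem relativeChainsMap_id {X : Type} [TopologicalSpace X] {A : Set X}
    (h : Set.MapsTo (ContinuousMap.id X) A A) :
    relativeChainsMap (ContinuousMap.id X) h = 𝟙 (relativeChains X A) := by
  apply relativeChains_hom_ext
  rw [relativeChainsπ_map, Category.comp_id]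
  exact (congrArg (· ≫ _) (singularChains.map_id _)).trans (Category.id_comp _)

theorem relativeChainsMap_comp {X Y Z : Type} [TopologicalSpace X] [TopologicalSpace Y]
    [TopologicalSpace Z] {A : Set X} {B : Set Y} {D : Set Z} (f : C(X, Y)) (g : C(Y, Z))
    (hf : Set.MapsTo f A B) (hg : Set.MapsTo g B D) (h : Set.MapsTo (g.comp f) A D) :
    relativeChainsMap (g.comp f) h = relativeChainsMap f hf ≫ relativeChainsMap g hg := by
  apply relativeChains_hom_ext
  rw [relativeChainsπ_map, ← Category.assoc, relativeChainsπ_map, Category.assoc,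
    relativeChainsπ_map, ← Category.assoc, ← Functor.map_comp]
  rfl

variable {K L P : ChainComplex (ModuleCat.{0} ℂ) ℕ} (n : ℕ)

theorem dualCohomologyMap_id : dualCohomologyMap n (𝟙 K) = LinearMap.id := by
  apply LinearMap.ext
  intro x
  obtain ⟨c, rfl⟩ := Submodule.mkQ_surjective _ x
  rfl

theorem dualCohomologyMap_comp (φ : K ⟶ L) (ψ : L ⟶ P) : dualCohomologyMap n (φ ≫ ψ) =
    (dualCohomologyMap n φ).comp (dualCohomologyMap n ψ) := by
  apply LinearMap.ext
  intro x
  obtain ⟨c, rfl⟩ := Submodule.mkQ_surjective _ x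
  rfl

/-- Homotopic maps of pairs induce the same map in relative cohomology. -/
theorem dualCohomologyMap_eq_of_homotopy {X Y : Type} [TopologicalSpace X] [TopologicalSpace Y]
    {A : Set X} {B : Set Y} {f g : C(X, Y)} (hf : Set.MapsTo f A B) (hg : Set.MapsTo g A B)
    (H : ContinuousMap.Homotopy f g) (hH : ∀ t, ∀ a ∈ A, H (t, a) ∈ B) :
    dualCohomologyMap n (relativeChainsMap f hf) = dualCohomologyMap n (relativeChainsMap g hg) := by
  let HA : TopCat.Homotopy (TopCat.ofHom ⟨hf.restrict f A B, f.continuous.restrict hf⟩ :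
      TopCat.of A ⟶ TopCat.of B) (TopCat.ofHom ⟨hg.restrict g A B, g.continuous.restrict hg⟩) :=
    { toFun := fun p => ⟨H (p.1, p.2.1), hH _ _ p.2.2⟩
      continuous_toFun := by
        refine Continuous.subtype_mk (H.continuous.comp ?_) _
        fun_prop
      map_zero_left := fun x => Subtype.ext (H.map_zero_left x.1)
      map_one_left := fun x => Subtype.ext (H.map_one_left x.1) }
  let HX : TopCat.Homotopy (TopCat.ofHom f : TopCat.of X ⟶ TopCat.of Y) (TopCat.ofHom g) := H
  have nat := chainHomotopy_naturality HA HX (inclusionMap X A) (inclusionMap Y B)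
    (fun t a => rfl)
  set s := HX.singularChainComplexFunctorObjMap (ModuleCat.of ℂ ℂ) with hs
  set sA := HA.singularChainComplexFunctorObjMap (ModuleCat.of ℂ ℂ) with hsA
  apply LinearMap.ext
  intro x
  obtain ⟨⟨c, hc⟩, rfl⟩ := Submodule.mkQ_surjective _ x
  let c' : (relativeChains Y B).X n ⟶ ModuleCat.of ℂ ℂ := ModuleCat.ofHom c
  have hc' : (relativeChains Y B).d (n + 1) n ≫ c' = 0 := ModuleCat.hom_ext hc
  have hcomm : (singularChains.map (TopCat.ofHom f : TopCat.of X ⟶ TopCat.of Y)).f n =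
      (singularChains.obj (TopCat.of X)).d n ((ComplexShape.down ℕ).next n) ≫
        s.hom ((ComplexShape.down ℕ).next n) n + s.hom n ((ComplexShape.down ℕ).prev n) ≫
        (singularChains.obj (TopCat.of Y)).d ((ComplexShape.down ℕ).prev n) n +
      (singularChains.map (TopCat.ofHom g : TopCat.of X ⟶ TopCat.of Y)).f n := s.comm n
  rw [ChainComplex.prev] at hcomm
  -- the cochain `c ∘ s` vanishes on chains in `A`, so it comes from a relative cochain `b`
  obtain ⟨b, hb⟩ := exists_relativeChainsπ_comp (X := X) (A := A)
    (s.hom ((ComplexShape.down ℕ).next n) n ≫ (relativeChainsπ Y B).f n ≫ c') (by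
      rw [← Category.assoc, nat, Category.assoc, ← Category.assoc _ _ c',
        ← HomologicalComplex.comp_f, inclusion_comp_relativeChainsπ]
      simp)
  have hf' := congrArg (fun φ => HomologicalComplex.Hom.f φ n) (relativeChainsπ_map f hf)
  have hg' := congrArg (fun φ => HomologicalComplex.Hom.f φ n) (relativeChainsπ_map g hg)
  simp only [HomologicalComplex.comp_f] at hf' hg'
  -- hence the pullbacks of the cocycle `c` along `f` and `g` differ by the coboundary of `b`
  have key : (relativeChainsMap f hf).f n ≫ c' = (relativeChainsMap g hg).f n ≫ c' +
      (relativeChains X A).d n ((ComplexShape.down ℕ).next n) ≫ b := by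
    rw [← cancel_epi ((relativeChainsπ X A).f n), Preadditive.comp_add, ← Category.assoc,
      ← Category.assoc, ← Category.assoc, hf', hg', HomologicalComplex.Hom.comm, Category.assoc,
      Category.assoc, Category.assoc, hb, hcomm, Preadditive.add_comp, Preadditive.add_comp,
      Category.assoc, Category.assoc, ← Category.assoc (HomologicalComplex.d _ (n + 1) n),
      ← HomologicalComplex.Hom.comm, Category.assoc, hc']
    simp [add_comm]
  refine (Submodule.Quotient.eq _).2 ?_
  refine ⟨b.hom, ?_⟩
  have key' := congrArg ModuleCat.Hom.hom key
  apply LinearMap.ext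
  intro z
  have kz := LinearMap.congr_fun key' z
  have e1 : c ((relativeChainsMap f hf).f n z) = c ((relativeChainsMap g hg).f n z) +
    b ((relativeChains X A).d n ((ComplexShape.down ℕ).next n) z) := kz
  change b ((relativeChains X A).d n ((ComplexShape.down ℕ).next n) z) =
    c ((relativeChainsMap f hf).f n z) - c ((relativeChainsMap g hg).f n z)
  rw [e1, add_sub_cancel_left]

section Equivariance

variable {σ : Type}

/-- The cohomology of the pairs `(ℂ^σ, A)` and `(ℂ^σ, B)` is isomorphic in every degree, by
isomorphisms that commute with pullback along the diagonal matrices in `S`. -/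
def EquivariantlyEquivalent (S : Set (σ → ℂˣ)) (A B : Set (σ → ℂ)) : Prop :=
  ∀ n, ∃ e : DualCohomology (relativeChains (σ → ℂ) A) n ≃ₗ[ℂ]
      DualCohomology (relativeChains (σ → ℂ) B) n,
    ∀ h ∈ S, ∀ (hA : Set.MapsTo (torusMap h) A A) (hB : Set.MapsTo (torusMap h) B B),
      ∀ c, e (dualCohomologyMap n (relativeChainsMap (torusMap h) hA) c) =
        dualCohomologyMap n (relativeChainsMap (torusMap h) hB) (e c)

theorem EquivariantlyEquivalent.trans {S : Set (σ → ℂˣ)} {A B D : Set (σ → ℂ)}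
    (h₁ : EquivariantlyEquivalent S A B) (h₂ : EquivariantlyEquivalent S B D)
    (hB : ∀ h ∈ S, Set.MapsTo (torusMap h) B B) : EquivariantlyEquivalent S A D := by
  intro n
  obtain ⟨e₁, he₁⟩ := h₁ n
  obtain ⟨e₂, he₂⟩ := h₂ n
  refine ⟨e₁.trans e₂, fun h hS hA hD c => ?_⟩
  rw [LinearEquiv.trans_apply, LinearEquiv.trans_apply, he₁ h hS hA (hB h hS),
    he₂ h hS (hB h hS) hD]

theorem EquivariantlyEquivalent.symm {S : Set (σ → ℂˣ)} {A B : Set (σ → ℂ)}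
    (h₁ : EquivariantlyEquivalent S A B) : EquivariantlyEquivalent S B A := by
  intro n
  obtain ⟨e₁, he₁⟩ := h₁ n
  refine ⟨e₁.symm, fun h hS hA hD c => ?_⟩
  rw [LinearEquiv.symm_apply_eq, he₁ h hS hD hA, LinearEquiv.apply_symm_apply]

/-- An equivariant homotopy equivalence of pairs gives an equivariant isomorphism in
cohomology. Only one of the two maps has to commute with the group action. -/
theorem equivariantlyEquivalent_of_homotopy {S : Set (σ → ℂˣ)} {A B : Set (σ → ℂ)}
    (f g : C(σ → ℂ, σ → ℂ)) (hf : Set.MapsTo f A B) (hg : Set.MapsTo g B A)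
    (H : ContinuousMap.Homotopy (.id _) (g.comp f)) (hH : ∀ t, ∀ a ∈ A, H (t, a) ∈ A)
    (H' : ContinuousMap.Homotopy (.id _) (f.comp g)) (hH' : ∀ t, ∀ a ∈ B, H' (t, a) ∈ B)
    (hS : ∀ h ∈ S, g.comp (torusMap h) = (torusMap h).comp g) :
    EquivariantlyEquivalent S A B := by
  intro n
  have hid : ∀ D : Set (σ → ℂ), Set.MapsTo (ContinuousMap.id (σ → ℂ)) D D := Set.mapsTo_id
  have hgf : Set.MapsTo (g.comp f) A A := hg.comp hf
  have hfg : Set.MapsTo (f.comp g) B B := hf.comp hg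
  have h1 := dualCohomologyMap_eq_of_homotopy n (hid A) hgf H hH
  have h2 := dualCohomologyMap_eq_of_homotopy n (hid B) hfg H' hH'
  rw [relativeChainsMap_id, dualCohomologyMap_id, relativeChainsMap_comp f g hf hg,
    dualCohomologyMap_comp] at h1
  rw [relativeChainsMap_id, dualCohomologyMap_id, relativeChainsMap_comp g f hg hf,
    dualCohomologyMap_comp] at h2
  refine ⟨LinearEquiv.ofLinearMap (dualCohomologyMap n (relativeChainsMap g hg))
    (dualCohomologyMap n (relativeChainsMap f hf)) h2.symm h1.symm, fun h hhS hA hB c => ?_⟩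
  have h3 : relativeChainsMap (torusMap h) hB ≫ relativeChainsMap g hg =
      relativeChainsMap g hg ≫ relativeChainsMap (torusMap h) hA := by
    have hgB : Set.MapsTo (g.comp (torusMap h)) B A := hg.comp hB
    have hAg : Set.MapsTo ((torusMap h).comp g) B A := hA.comp hg
    rw [← relativeChainsMap_comp _ _ hB hg hgB, ← relativeChainsMap_comp _ _ hg hA hAg]
    simp only [hS h hhS]
  have h4 := congrArg (dualCohomologyMap n) h3
  rw [dualCohomologyMap_comp, dualCohomologyMap_comp] at h4
  exact (LinearMap.congr_fun h4 c).symm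

end Equivariance

end FJRW

end

/-! ### Weighted scaling and the quasi-norm -/

namespace FJRW

open MvPolynomial Topology

variable {σ : Type} [Fintype σ]

/-- The weighted scaling `x_i ↦ l ^ q_i x_i`, with real powers; it is meant for `l > 0`. -/
def weightedScale (q : σ → ℚ) (l : ℝ) : C(σ → ℂ, σ → ℂ) :=
  ⟨fun x i => ((l ^ (q i : ℝ) : ℝ) : ℂ) * x i, by fun_prop⟩

theorem weightedScale_apply (q : σ → ℚ) (l : ℝ) (x : σ → ℂ) (i : σ) :
    weightedScale q l x i = ((l ^ (q i : ℝ) : ℝ) : ℂ) * x i := rfl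

theorem weightedScale_mul (q : σ → ℚ) {l m : ℝ} (hl : 0 ≤ l) (hm : 0 ≤ m) (x : σ → ℂ) :
    weightedScale q l (weightedScale q m x) = weightedScale q (l * m) x := by
  funext i
  simp only [weightedScale_apply]
  rw [Real.mul_rpow hl hm]
  push_cast
  ring

theorem weightedScale_one (q : σ → ℚ) (x : σ → ℂ) : weightedScale q 1 x = x := by
  funext i
  simp [weightedScale_apply]

theorem eval_weightedScale {q : σ → ℚ} {V : MvPolynomial σ ℂ} {d : ℚ}
    (hV : IsWeightedHomogeneous q V d) {l : ℝ} (hl : 0 < l) (x : σ → ℂ) :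
    eval (weightedScale q l x) V = ((l ^ (d : ℝ) : ℝ) : ℂ) * eval x V := by
  rw [eval_eq', eval_eq', Finset.mul_sum]
  refine Finset.sum_congr rfl fun a ha => ?_
  have hw : ∑ i, (a i : ℝ) * (q i : ℝ) = d := by
    have h := hV (mem_support_iff.1 ha)
    rw [Finsupp.weight_apply, Finsupp.sum_fintype _ _ (by simp)] at h
    rw [← h]
    push_cast
    simp
  have hp : ∏ i, (((l ^ (q i : ℝ) : ℝ) : ℂ)) ^ a i = ((l ^ (d : ℝ) : ℝ) : ℂ) := by
    rw [← hw, Real.rpow_sum_of_pos hl]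
    push_cast
    refine Finset.prod_congr rfl fun i _ => ?_
    rw [← Complex.ofReal_pow, ← Real.rpow_natCast, ← Real.rpow_mul hl.le, mul_comm]
  simp only [weightedScale_apply, mul_pow, Finset.prod_mul_distrib, hp]
  ring

/-- The quasi-norm `∑ |x_i| ^ (1 / q_i)`, of weighted degree one. -/
def quasiNorm (q : σ → ℚ) (x : σ → ℂ) : ℝ := ∑ i, ‖x i‖ ^ (1 / (q i : ℝ))

section QuasiNorm

variable {q : σ → ℚ} (hq : ∀ i, 0 < q i)

include hq

theorem continuous_quasiNorm : Continuous (quasiNorm q) := by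
  unfold quasiNorm
  refine continuous_finsetSum _ fun i _ => ?_
  have : (0 : ℝ) < q i := by exact_mod_cast hq i
  exact Continuous.rpow_const (by fun_prop) fun _ => Or.inr (by positivity)

theorem quasiNorm_weightedScale {l : ℝ} (hl : 0 < l) (x : σ → ℂ) :
    quasiNorm q (weightedScale q l x) = l * quasiNorm q x := by
  rw [quasiNorm, quasiNorm, Finset.mul_sum]
  refine Finset.sum_congr rfl fun i _ => ?_
  have : (0 : ℝ) < q i := by exact_mod_cast hq i
  rw [weightedScale_apply, norm_mul, Complex.norm_real, Real.norm_of_nonneg (by positivity),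
    Real.mul_rpow (by positivity) (by positivity), ← Real.rpow_mul hl.le,
    mul_one_div_cancel this.ne', Real.rpow_one]

theorem quasiNorm_pos {x : σ → ℂ} (hx : x ≠ 0) : 0 < quasiNorm q x := by
  obtain ⟨i, hi⟩ := Function.ne_iff.1 hx
  refine Finset.sum_pos' (fun i _ => by positivity) ⟨i, Finset.mem_univ _, ?_⟩
  have : 0 < ‖x i‖ := norm_pos_iff.2 hi
  positivity

theorem quasiNorm_zero : quasiNorm q (0 : σ → ℂ) = 0 := by
  refine Finset.sum_eq_zero fun i _ => ?_
  have : (0 : ℝ) < q i := by exact_mod_cast hq i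
  rw [Pi.zero_apply, norm_zero, Real.zero_rpow (by positivity)]

theorem isCompact_quasiSphere : IsCompact {x : σ → ℂ | quasiNorm q x = 1} := by
  refine IsCompact.of_isClosed_subset (isCompact_closedBall (0 : σ → ℂ) 1)
    (isClosed_eq (continuous_quasiNorm hq) continuous_const) fun x hx => ?_
  rw [mem_closedBall_zero_iff, pi_norm_le_iff_of_nonneg zero_le_one]
  intro i
  have hqi : (0 : ℝ) < q i := by exact_mod_cast hq i
  have h1 : ‖x i‖ ^ (1 / (q i : ℝ)) ≤ 1 := by
    refine le_of_le_of_eq ?_ (show quasiNorm q x = 1 from hx)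
    exact Finset.single_le_sum (f := fun i => ‖x i‖ ^ (1 / (q i : ℝ)))
      (fun i _ => by positivity) (Finset.mem_univ i)
  by_contra! h
  exact absurd (Real.one_lt_rpow h (by positivity)) (not_lt.2 h1)

/-- Every nonzero vector is a scaled vector of quasi-norm one. -/
theorem exists_weightedScale_eq {x : σ → ℂ} (hx : x ≠ 0) :
    ∃ s, quasiNorm q s = 1 ∧ weightedScale q (quasiNorm q x) s = x := by
  have hpos := quasiNorm_pos hq hx
  refine ⟨weightedScale q (quasiNorm q x)⁻¹ x, ?_, ?_⟩
  · rw [quasiNorm_weightedScale hq (by positivity), inv_mul_cancel₀ hpos.ne']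
  · rw [weightedScale_mul q hpos.le (by positivity), mul_inv_cancel₀ hpos.ne', weightedScale_one]

end QuasiNorm

theorem hasDerivAt_eval_add_mul (V : MvPolynomial σ ℂ) (x v : σ → ℂ) (t : ℝ) :
    HasDerivAt (fun t : ℝ => eval (fun i => x i + (t : ℂ) * v i) V)
      (∑ i, v i * eval (fun i => x i + (t : ℂ) * v i) (pderiv i V)) t := by
  classical
  induction V using MvPolynomial.induction_on with
  | C a => simpa using hasDerivAt_const t a
  | add p r hp hr =>
    simp only [map_add, mul_add, Finset.sum_add_distrib]
    exact hp.add hr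
  | mul_X p j hp =>
    have hX : HasDerivAt (fun t : ℝ => x j + (t : ℂ) * v j) (v j) t := by
      simpa using ((Complex.ofRealCLM.hasDerivAt (x := t)).mul_const (v j)).const_add (x j)
    have h := hp.mul hX
    simp only [map_mul, eval_X]
    refine h.congr_deriv ?_
    simp only [Derivation.leibniz, pderiv_X, smul_eq_mul, map_add, map_mul, eval_X, mul_add,
      Finset.sum_add_distrib]
    rw [add_comm]
    congr 1
    · rw [Finset.sum_eq_single j]
      · simp [mul_comm]
      · intro b _ hb
        simp [Pi.single_eq_of_ne hb.symm]
      · simp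
    · rw [← mul_add, Finset.sum_mul]
      exact Finset.sum_congr rfl fun i _ => by ring

end FJRW

/-! ### Deformation of the upper sets -/

namespace FJRW

open MvPolynomial Topology ComplexConjugate

variable {σ : Type} [Fintype σ]

theorem eval_substTorus (h : σ → ℂˣ) (x : σ → ℂ) (P : MvPolynomial σ ℂ) :
    eval x (substTorus h P) = eval (torusMap h x) P := by
  have h' : (eval x).comp (substTorus h).toRingHom = eval (torusMap h x) := by
    refine MvPolynomial.ringHom_ext ?_ ?_
    · intro r; simp [substTorus]
    · intro i; simp [substTorus, torusMap]
  exact congrArg (fun φ => φ P) h'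

theorem eval_pderiv_torusMap {V : MvPolynomial σ ℂ} {h : σ → ℂˣ} (hV : h ∈ maxSymmetryGroup V)
    (x : σ → ℂ) (i : σ) :
    (h i : ℂ) * eval (torusMap h x) (pderiv i V) = eval x (pderiv i V) := by
  have h1 := pderiv_substTorus h i V
  rw [substTorus_eq ⟨h, hV⟩] at h1
  conv_rhs => rw [h1]
  rw [map_mul, eval_C, eval_substTorus]

/-- The conjugate gradient of `V`, normalized on `{quasiNorm ≥ 1}` so as to commute with the
weighted scaling: the derivative `∂_i V` has weighted degree `1 - q_i`, and the power `2 q_i - 1` of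
the quasi-norm raises it to the degree `q_i` of the `i`-th coordinate. The maximum with `1` keeps the
field continuous at the origin. -/
def pushField (q : σ → ℚ) (V : MvPolynomial σ ℂ) (x : σ → ℂ) (i : σ) : ℂ :=
  conj (eval x (pderiv i V)) * ((max (quasiNorm q x) 1 ^ (2 * (q i : ℝ) - 1) : ℝ) : ℂ)

/-- The map that moves every point for the time `t` in the direction of `pushField`. -/
def push (q : σ → ℚ) (V : MvPolynomial σ ℂ) (t : ℝ) (x : σ → ℂ) : σ → ℂ :=
  fun i => x i + (t : ℂ) * pushField q V x i

theorem push_zero (q : σ → ℚ) (V : MvPolynomial σ ℂ) (x : σ → ℂ) : push q V 0 x = x := by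
  funext i
  simp [push]

section

variable {q : σ → ℚ} (hq : ∀ i, 0 < q i) {V P : MvPolynomial σ ℂ}

include hq

theorem continuous_pushField : Continuous (pushField q V) := by
  refine continuous_pi fun i => Continuous.mul ?_ ?_
  · exact Complex.continuous_conj.comp (MvPolynomial.continuous_eval _)
  · refine Complex.continuous_ofReal.comp (Continuous.rpow_const ?_ fun x => Or.inl ?_)
    · exact (continuous_quasiNorm hq).max continuous_const
    · positivity

theorem continuous_push : Continuous fun p : ℝ × (σ → ℂ) => push q V p.1 p.2 := by
  refine continuous_pi fun i => ?_
  have h1 : Continuous fun p : ℝ × (σ → ℂ) => pushField q V p.2 i :=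
    (continuous_apply i).comp ((continuous_pushField hq).comp continuous_snd)
  unfold push
  fun_prop

theorem push_weightedScale (hV : IsWeightedHomogeneous q V 1) {l : ℝ} (hl : 1 ≤ l) {x : σ → ℂ}
    (hx : quasiNorm q x = 1) (t : ℝ) :
    push q V t (weightedScale q l x) = weightedScale q l (push q V t x) := by
  have hl0 : 0 < l := by linarith
  funext i
  have hd : IsWeightedHomogeneous q (pderiv i V) (1 - q i) := hV.pderiv (by ring)
  simp only [push, pushField, weightedScale_apply, eval_weightedScale hd hl0,
    quasiNorm_weightedScale hq hl0, hx, mul_one, max_eq_left hl, max_self, Real.one_rpow, map_mul,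
    Complex.conj_ofReal]
  have h2 : l ^ (((1 - q i : ℚ)) : ℝ) * l ^ (2 * (q i : ℝ) - 1) = l ^ (q i : ℝ) := by
    rw [← Real.rpow_add hl0]
    congr 1
    push_cast
    ring
  rw [← h2]
  push_cast
  ring

theorem push_torusMap {h : σ → ℂˣ} (hV : h ∈ maxSymmetryGroup V) (hh : ∀ i, ‖(h i : ℂ)‖ = 1)
    (t : ℝ) (x : σ → ℂ) : push q V t (torusMap h x) = torusMap h (push q V t x) := by
  funext i
  have hn : quasiNorm q (torusMap h x) = quasiNorm q x := by
    simp [quasiNorm, torusMap, hh]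
  have h1 : (h i : ℂ) * conj (h i : ℂ) = 1 := by
    rw [Complex.mul_conj, Complex.normSq_eq_norm_sq, hh]; simp
  have h2 : (h i : ℂ) * conj (eval x (pderiv i V)) = conj (eval (torusMap h x) (pderiv i V)) := by
    rw [← eval_pderiv_torusMap hV x i, map_mul, ← mul_assoc, h1, one_mul]
  change (h i : ℂ) * x i + (t : ℂ) * pushField q V (torusMap h x) i =
    (h i : ℂ) * (x i + (t : ℂ) * pushField q V x i)
  simp only [pushField, hn, ← h2]
  ring

/-- The derivative of `Re (V + s P)` along the push is positive on the quasi-sphere, for small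
times and small `s`: it is the squared norm of the gradient of `V` when both vanish. -/
theorem eventually_push_deriv_pos (hcrit : ∀ x, IsSingularPoint V x → x = 0) :
    ∀ᶠ z : ℂ × ℝ in 𝓝 0, ∀ x ∈ {x : σ → ℂ | quasiNorm q x = 1},
      0 < (∑ i, pushField q V x i * eval (push q V z.2 x) (pderiv i (V + z.1 • P))).re := by
  refine (isCompact_quasiSphere hq).eventually_forall_of_forall_eventually fun x hx => ?_
  have hc : Continuous fun p : (ℂ × ℝ) × (σ → ℂ) =>
      (∑ i, pushField q V p.2 i *
        eval (push q V p.1.2 p.2) (pderiv i (V + p.1.1 • P))).re := by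
    refine Complex.continuous_re.comp (continuous_finsetSum _ fun i _ => ?_)
    refine ((continuous_apply i).comp ((continuous_pushField hq).comp continuous_snd)).mul ?_
    have hp : Continuous fun p : (ℂ × ℝ) × (σ → ℂ) => push q V p.1.2 p.2 :=
      (continuous_push hq).comp (by fun_prop : Continuous fun p : (ℂ × ℝ) × (σ → ℂ) =>
        (p.1.2, p.2))
    simp only [map_add, Derivation.map_smul, smul_eval]
    exact ((MvPolynomial.continuous_eval _).comp hp).add
      ((by fun_prop : Continuous fun p : (ℂ × ℝ) × (σ → ℂ) => p.1.1).mul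
        ((MvPolynomial.continuous_eval _).comp hp))
  refine hc.continuousAt.eventually (lt_mem_nhds ?_)
  have hx0 : x ≠ 0 := by
    rintro rfl
    rw [Set.mem_ofPred_eq, quasiNorm_zero hq] at hx
    exact zero_ne_one hx
  obtain ⟨i, hi⟩ : ∃ i, eval x (pderiv i V) ≠ 0 := by
    by_contra! h
    exact hx0 (hcrit x h)
  simp only [Prod.snd_zero, Prod.fst_zero, push_zero, zero_smul, add_zero, Complex.re_sum]
  have hterm : ∀ j, (pushField q V x j * eval x (pderiv j V)).re =
      Complex.normSq (eval x (pderiv j V)) := by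
    intro j
    rw [Set.mem_ofPred_eq] at hx
    simp only [pushField, hx, max_self, Real.one_rpow, Complex.ofReal_one, mul_one]
    rw [mul_comm, Complex.mul_conj, Complex.ofReal_re]
  simp only [hterm]
  exact Finset.sum_pos' (fun j _ => Complex.normSq_nonneg _)
    ⟨i, Finset.mem_univ _, Complex.normSq_pos.2 hi⟩

/-- On the quasi-sphere the push raises `Re (V + s P)`, and for a fixed time `T` it does so by more
than a change of the small parameter `s` can undo. -/
theorem exists_push_increasing (hcrit : ∀ x, IsSingularPoint V x → x = 0) :
    ∃ δ > 0, ∃ T > 0, (∀ s : ℂ, ‖s‖ < δ → ∀ t ∈ Set.Icc 0 T, ∀ x, quasiNorm q x = 1 →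
        (eval x (V + s • P)).re ≤ (eval (push q V t x) (V + s • P)).re) ∧
      ∀ s s' : ℂ, ‖s‖ < δ → ‖s'‖ < δ → ∀ x, quasiNorm q x = 1 →
        (eval x (V + s • P)).re < (eval (push q V T x) (V + s' • P)).re := by
  obtain ⟨δ, hδ, hpos⟩ := Metric.eventually_nhds_iff.1
    (eventually_push_deriv_pos (P := P) hq hcrit)
  have hmono : ∀ s : ℂ, ‖s‖ < δ → ∀ x, quasiNorm q x = 1 →
      StrictMonoOn (fun t => (eval (push q V t x) (V + s • P)).re) (Set.Icc 0 (δ / 2)) := by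
    intro s hs x hx
    have hd : ∀ t : ℝ, HasDerivAt (fun t : ℝ => (eval (push q V t x) (V + s • P)).re)
        (∑ i, pushField q V x i * eval (push q V t x) (pderiv i (V + s • P))).re t := fun t =>
      Complex.reCLM.hasFDerivAt.comp_hasDerivAt t
        (hasDerivAt_eval_add_mul (V + s • P) x (pushField q V x) t)
    refine strictMonoOn_of_deriv_pos (convex_Icc _ _)
      (fun t _ => (hd t).continuousAt.continuousWithinAt) fun t ht => ?_
    rw [interior_Icc, Set.mem_Ioo] at ht
    rw [(hd t).deriv]
    refine hpos (y := (s, t)) ?_ x hx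
    rw [dist_zero_right, Prod.norm_def, max_lt_iff]
    refine ⟨hs, ?_⟩
    rw [Real.norm_of_nonneg ht.1.le]
    linarith
  have h2 : ∀ᶠ z : ℂ × ℂ in 𝓝 0, ∀ x ∈ {x : σ → ℂ | quasiNorm q x = 1},
      (eval x (V + z.1 • P)).re < (eval (push q V (δ / 2) x) (V + z.2 • P)).re := by
    refine (isCompact_quasiSphere hq).eventually_forall_of_forall_eventually fun x hx => ?_
    have hp : Continuous fun p : (ℂ × ℂ) × (σ → ℂ) => push q V (δ / 2) p.2 :=
      (continuous_push hq).comp (by fun_prop : Continuous fun p : (ℂ × ℂ) × (σ → ℂ) =>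
        (δ / 2, p.2))
    have hc1 : Continuous fun p : (ℂ × ℂ) × (σ → ℂ) => (eval p.2 (V + p.1.1 • P)).re := by
      simp only [map_add, smul_eval]
      exact Complex.continuous_re.comp
        (((MvPolynomial.continuous_eval _).comp continuous_snd).add
        ((by fun_prop : Continuous fun p : (ℂ × ℂ) × (σ → ℂ) => p.1.1).mul
          ((MvPolynomial.continuous_eval _).comp continuous_snd)))
    have hc2 : Continuous fun p : (ℂ × ℂ) × (σ → ℂ) =>
        (eval (push q V (δ / 2) p.2) (V + p.1.2 • P)).re := by
      simp only [map_add, smul_eval]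
      exact Complex.continuous_re.comp
        (((MvPolynomial.continuous_eval _).comp hp).add
        ((by fun_prop : Continuous fun p : (ℂ × ℂ) × (σ → ℂ) => p.1.2).mul
          ((MvPolynomial.continuous_eval _).comp hp)))
    refine hc1.continuousAt.eventually_lt hc2.continuousAt ?_
    have := hmono 0 (by simpa using hδ) x hx (Set.left_mem_Icc.2 (by positivity))
      (Set.right_mem_Icc.2 (by positivity)) (by positivity)
    simpa [push_zero] using this
  obtain ⟨ε, hε, h3⟩ := Metric.eventually_nhds_iff.1 h2
  refine ⟨min δ ε, lt_min hδ hε, δ / 2, by positivity, fun s hs t ht x hx => ?_,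
    fun s s' hs hs' x hx => ?_⟩
  · have := (hmono s (hs.trans_le (min_le_left _ _)) x hx).monotoneOn
      (Set.left_mem_Icc.2 (by positivity)) ht ht.1
    simpa [push_zero] using this
  · refine h3 (y := (s, s')) ?_ x hx
    rw [dist_zero_right, Prod.norm_def, max_lt_iff]
    exact ⟨hs.trans_le (min_le_right _ _), hs'.trans_le (min_le_right _ _)⟩

theorem exists_eval_le_mul_quasiNorm (hV : IsWeightedHomogeneous q V 1)
    (hP : IsWeightedHomogeneous q P 1) :
    ∃ C, 0 ≤ C ∧ ∀ s : ℂ, ‖s‖ ≤ 1 → ∀ x, (eval x (V + s • P)).re ≤ C * quasiNorm q x := by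
  have hc : ContinuousOn (fun x : σ → ℂ => ‖eval x V‖ + ‖eval x P‖)
      {x : σ → ℂ | quasiNorm q x = 1} :=
    ((MvPolynomial.continuous_eval V).norm.add (MvPolynomial.continuous_eval P).norm).continuousOn
  obtain ⟨C, hC⟩ := (isCompact_quasiSphere hq).bddAbove_image hc
  refine ⟨max C 0, le_max_right _ _, fun s hs x => ?_⟩
  have hsph : ∀ y, quasiNorm q y = 1 → (eval y (V + s • P)).re ≤ max C 0 := by
    intro y hy
    have h1 : ‖eval y V‖ + ‖eval y P‖ ≤ C := hC ⟨y, hy, rfl⟩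
    calc (eval y (V + s • P)).re ≤ ‖eval y (V + s • P)‖ := Complex.re_le_norm _
      _ ≤ ‖eval y V‖ + ‖s‖ * ‖eval y P‖ := by
        rw [map_add, smul_eval, ← norm_mul]
        exact norm_add_le _ _
      _ ≤ ‖eval y V‖ + ‖eval y P‖ := by nlinarith [norm_nonneg (eval y P)]
      _ ≤ max C 0 := h1.trans (le_max_left _ _)
  have hVP : IsWeightedHomogeneous q (V + s • P) 1 :=
    hV.add ((weightedHomogeneousSubmodule ℂ q 1).smul_mem s hP)
  by_cases hx : x = 0
  · subst hx
    have h0 := eval_weightedScale hVP (l := 2) (by norm_num) (0 : σ → ℂ)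
    have h1 : weightedScale q 2 (0 : σ → ℂ) = 0 := by
      funext i
      simp [weightedScale_apply]
    rw [h1, Rat.cast_one, Real.rpow_one, Complex.ofReal_ofNat] at h0
    have h2 : eval (0 : σ → ℂ) (V + s • P) = 0 := by
      linear_combination -h0
    rw [h2, quasiNorm_zero hq]
    simp
  · obtain ⟨y, hy, hyx⟩ := exists_weightedScale_eq hq hx
    have hpos := quasiNorm_pos hq hx
    have h1 := eval_weightedScale hVP hpos y
    rw [hyx] at h1
    rw [h1, Rat.cast_one, Real.rpow_one, Complex.re_ofReal_mul, mul_comm]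
    exact mul_le_mul_of_nonneg_right (hsph y hy) hpos.le

/-- For a large cut-off, the pairs of `V` and of its small perturbations are equivalent: the push
maps each of the upper sets into each other one. -/
theorem exists_equivariantlyEquivalent_perturbation (hV : IsWeightedHomogeneous q V 1)
    (hP : IsWeightedHomogeneous q P 1) (hcrit : ∀ x, IsSingularPoint V x → x = 0)
    {S : Set (σ → ℂˣ)} (hS : ∀ h ∈ S, ∀ i, ‖(h i : ℂ)‖ = 1)
    (hSV : ∀ h ∈ S, h ∈ maxSymmetryGroup V) :
    ∃ δ > 0, ∃ M > 0, ∀ s : ℂ, ‖s‖ < δ →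
      EquivariantlyEquivalent S (upperSet V M) (upperSet (V + s • P) M) := by
  obtain ⟨δ, hδ, T, hT, h1, h2⟩ := exists_push_increasing (P := P) hq hcrit
  obtain ⟨C, hC0, hC⟩ := exists_eval_le_mul_quasiNorm hq hV hP
  have hhom : ∀ s : ℂ, IsWeightedHomogeneous q (V + s • P) 1 := fun s =>
    hV.add ((weightedHomogeneousSubmodule ℂ q 1).smul_mem s hP)
  -- above the cut-off `C + 1` every point has quasi-norm at least one
  have hlarge : ∀ s : ℂ, ‖s‖ < min δ 1 → ∀ x ∈ upperSet (V + s • P) (C + 1),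
      ∃ l y, 1 ≤ l ∧ quasiNorm q y = 1 ∧ weightedScale q l y = x := by
    intro s hs x hx
    have hx1 : C + 1 < C * quasiNorm q x :=
      lt_of_lt_of_le hx (hC s (hs.le.trans (min_le_right _ _)) x)
    have hx0 : x ≠ 0 := by
      rintro rfl
      rw [quasiNorm_zero hq] at hx1
      linarith
    obtain ⟨y, hy, hyx⟩ := exists_weightedScale_eq hq hx0
    refine ⟨_, y, ?_, hy, hyx⟩
    by_contra! hlt
    nlinarith
  have hre : ∀ (s : ℂ) (l : ℝ), 1 ≤ l → ∀ y,
      (eval (weightedScale q l y) (V + s • P)).re = l * (eval y (V + s • P)).re := by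
    intro s l hl y
    rw [eval_weightedScale (hhom s) (by linarith), Rat.cast_one, Real.rpow_one,
      Complex.re_ofReal_mul]
  -- both inequalities on the quasi-sphere extend to the upper sets by homogeneity: the push for
  -- times up to `T` keeps each upper set, and for the time `T` it maps one into the other
  have hA : ∀ s : ℂ, ‖s‖ < min δ 1 → ∀ t ∈ Set.Icc 0 T, ∀ x ∈ upperSet (V + s • P) (C + 1),
      push q V t x ∈ upperSet (V + s • P) (C + 1) := by
    intro s hs t ht x hx
    obtain ⟨l, y, hl, hy, rfl⟩ := hlarge s hs x hx
    change C + 1 < (eval _ (V + s • P)).re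
    refine lt_of_lt_of_le (show C + 1 < (eval _ (V + s • P)).re from hx) ?_
    rw [push_weightedScale hq hV hl hy, hre s l hl, hre s l hl]
    exact mul_le_mul_of_nonneg_left (h1 s (hs.trans_le (min_le_left _ _)) t ht y hy)
      (by linarith)
  have hB : ∀ s s' : ℂ, ‖s‖ < min δ 1 → ‖s'‖ < min δ 1 → ∀ x ∈ upperSet (V + s • P) (C + 1),
      push q V T x ∈ upperSet (V + s' • P) (C + 1) := by
    intro s s' hs hs' x hx
    obtain ⟨l, y, hl, hy, rfl⟩ := hlarge s hs x hx
    change C + 1 < (eval _ (V + s' • P)).re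
    refine lt_of_lt_of_le (show C + 1 < (eval _ (V + s • P)).re from hx) ?_
    rw [push_weightedScale hq hV hl hy, hre s l hl, hre s' l hl]
    exact mul_le_mul_of_nonneg_left (h2 s s' (hs.trans_le (min_le_left _ _))
      (hs'.trans_le (min_le_left _ _)) y hy).le (by linarith)
  refine ⟨min δ 1, lt_min hδ one_pos, C + 1, by linarith, fun s hs => ?_⟩
  have h0 : ‖(0 : ℂ)‖ < min δ 1 := by
    rw [norm_zero]
    exact lt_min hδ one_pos
  have hV0 : upperSet V (C + 1) = upperSet (V + (0 : ℂ) • P) (C + 1) := by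
    rw [zero_smul, add_zero]
  rw [hV0]
  -- the push for the time `T` is its own homotopy inverse, through the pushes for smaller times
  let f : C(σ → ℂ, σ → ℂ) := ⟨push q V T, (continuous_push hq).comp
    (by fun_prop : Continuous fun x : σ → ℂ => (T, x))⟩
  let H : ContinuousMap.Homotopy (.id (σ → ℂ)) (f.comp f) :=
    { toFun := fun p => push q V (p.1 * T) (push q V (p.1 * T) p.2)
      continuous_toFun := by
        have h3 : Continuous fun p : unitInterval × (σ → ℂ) => push q V (p.1 * T) p.2 :=
          (continuous_push hq).comp (by fun_prop : Continuous fun p : unitInterval × (σ → ℂ) =>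
            ((p.1 : ℝ) * T, p.2))
        exact (continuous_push hq).comp
          ((by fun_prop : Continuous fun p : unitInterval × (σ → ℂ) => (p.1 : ℝ) * T).prodMk h3)
      map_zero_left := fun x => by simp [push_zero]
      map_one_left := fun x => by simp [f] }
  have ht : ∀ t : unitInterval, (t : ℝ) * T ∈ Set.Icc 0 T := fun t =>
    ⟨mul_nonneg t.2.1 hT.le, mul_le_of_le_one_left hT.le t.2.2⟩
  refine equivariantlyEquivalent_of_homotopy f f (hB 0 s h0 hs) (hB s 0 hs h0)
    H (fun t x hx => hA 0 h0 _ (ht t) _ (hA 0 h0 _ (ht t) x hx))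
    H (fun t x hx => hA s hs _ (ht t) _ (hA s hs _ (ht t) x hx)) fun h hh => ?_
  ext1 x
  exact push_torusMap hq (hSV h hh) (hS h hh) T x

/-- The weighted scaling identifies the pairs of different cut-offs. -/
theorem equivariantlyEquivalent_upperSet (S : Set (σ → ℂˣ)) (hV : IsWeightedHomogeneous q V 1)
    {M M' : ℝ} (hM : 0 < M) (hM' : 0 < M') :
    EquivariantlyEquivalent S (upperSet V M) (upperSet V M') := by
  have hmaps : ∀ {a b : ℝ}, 0 < a → 0 < b →
      Set.MapsTo (weightedScale q (b / a)) (upperSet V a) (upperSet V b) := by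
    intro a b ha hb x hx
    have hx' : a < (eval x V).re := hx
    change b < (eval (weightedScale q (b / a) x) V).re
    rw [eval_weightedScale hV (by positivity), Rat.cast_one, Real.rpow_one,
      Complex.re_ofReal_mul, div_mul_eq_mul_div, lt_div_iff₀ ha]
    exact mul_lt_mul_of_pos_left hx' hb
  have hinv : ∀ {a b : ℝ}, 0 < a → 0 < b →
      (weightedScale q (a / b)).comp (weightedScale (σ := σ) q (b / a)) = .id _ := by
    intro a b ha hb
    ext1 x
    rw [ContinuousMap.comp_apply, weightedScale_mul q (by positivity) (by positivity),
      div_mul_div_cancel₀ hb.ne', div_self ha.ne', weightedScale_one]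
    rfl
  refine equivariantlyEquivalent_of_homotopy (weightedScale q (M' / M)) (weightedScale q (M / M'))
    (hmaps hM hM') (hmaps hM' hM)
    ((ContinuousMap.Homotopy.refl _).cast rfl (hinv hM hM').symm) (fun t x hx => hx)
    ((ContinuousMap.Homotopy.refl _).cast rfl (hinv hM' hM).symm) (fun t x hx => hx) fun h _ => ?_
  ext x i
  simp only [ContinuousMap.comp_apply, weightedScale_apply, torusMap, ContinuousMap.coe_mk]
  ring

end

end FJRW

/-! ### Exactness of Koszul complexes -/

namespace FJRW

section Contraction

variable {R M : Type*} [CommRing R] [AddCommGroup M] [Module R M]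

/-- Contraction of the exterior algebra by a linear form, the differential of the Koszul
complex. -/
def contraction (f : Module.Dual R M) : ExteriorAlgebra R M →ₗ[R] ExteriorAlgebra R M :=
  CliffordAlgebra.contractLeft f

theorem contraction_ι_mul (f : Module.Dual R M) (v : M) (z : ExteriorAlgebra R M) :
    contraction f (ExteriorAlgebra.ι R v * z) = f v • z - ExteriorAlgebra.ι R v * contraction f z :=
  CliffordAlgebra.contractLeft_ι_mul ..

theorem contraction_ι (f : Module.Dual R M) (v : M) :
    contraction f (ExteriorAlgebra.ι R v) = algebraMap R _ (f v) :=
  CliffordAlgebra.contractLeft_ι ..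

theorem contraction_algebraMap (f : Module.Dual R M) (r : R) :
    contraction f (algebraMap R (ExteriorAlgebra R M) r) = 0 :=
  CliffordAlgebra.contractLeft_algebraMap ..

theorem contraction_contraction (f : Module.Dual R M) (z : ExteriorAlgebra R M) :
    contraction f (contraction f z) = 0 :=
  CliffordAlgebra.contractLeft_contractLeft ..

theorem contraction_comm (f g : Module.Dual R M) (z : ExteriorAlgebra R M) :
    contraction f (contraction g z) = -contraction g (contraction f z) :=
  CliffordAlgebra.contractLeft_comm ..

theorem ι_mul_mem_exteriorPower (v : M) {m : ℕ} {z : ExteriorAlgebra R M} (hz : z ∈ ⋀[R]^m M) :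
    ExteriorAlgebra.ι R v * z ∈ ⋀[R]^(m + 1) M := by
  rw [ExteriorAlgebra.exteriorPower, pow_succ']
  exact Submodule.mul_mem_mul ⟨v, rfl⟩ hz

theorem exteriorPower_succ_induction {m : ℕ} {p : ExteriorAlgebra R M → Prop}
    (hmul : ∀ v, ∀ z ∈ ⋀[R]^m M, p (ExteriorAlgebra.ι R v * z))
    (hadd : ∀ z w, p z → p w → p (z + w)) {z : ExteriorAlgebra R M} (hz : z ∈ ⋀[R]^(m + 1) M) :
    p z := by
  rw [ExteriorAlgebra.exteriorPower, pow_succ'] at hz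
  refine Submodule.mul_induction_on hz ?_ hadd
  rintro _ ⟨v, rfl⟩ z hz
  exact hmul v z hz

theorem contraction_mem_exteriorPower (f : Module.Dual R M) {m : ℕ} {z : ExteriorAlgebra R M}
    (hz : z ∈ ⋀[R]^(m + 1) M) : contraction f z ∈ ⋀[R]^m M := by
  induction m generalizing z with
  | zero =>
    refine exteriorPower_succ_induction (p := fun z => contraction f z ∈ ⋀[R]^0 M)
      (fun v z hz => ?_) (fun z w hz hw => ?_) hz
    · rw [ExteriorAlgebra.exteriorPower, pow_zero] at hz
      obtain ⟨r, rfl⟩ := Submodule.mem_one.1 hz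
      rw [contraction_ι_mul, contraction_algebraMap, mul_zero, sub_zero,
        ExteriorAlgebra.exteriorPower, pow_zero]
      exact Submodule.smul_mem _ _ (Submodule.mem_one.2 ⟨r, rfl⟩)
    · rw [map_add]
      exact add_mem hz hw
  | succ m ih =>
    refine exteriorPower_succ_induction (p := fun z => contraction f z ∈ ⋀[R]^(m + 1) M)
      (fun v z hz => ?_) (fun z w hz hw => ?_) hz
    · rw [contraction_ι_mul]
      exact sub_mem (Submodule.smul_mem _ _ hz) (ι_mul_mem_exteriorPower v (ih hz))
    · rw [map_add]
      exact add_mem hz hw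

theorem contraction_prod_ι (f : Module.Dual R M) (l : List M) (hl : ∀ v ∈ l, f v = 0) :
    contraction f (l.map (ExteriorAlgebra.ι R)).prod = 0 := by
  induction l with
  | nil => simpa using contraction_algebraMap f (1 : R)
  | cons v l ih =>
    rw [List.map_cons, List.prod_cons, contraction_ι_mul, hl v (by simp),
      ih fun w hw => hl w (by simp [hw])]
    simp

theorem prod_ι_mem_exteriorPower (l : List M) :
    (l.map (ExteriorAlgebra.ι R)).prod ∈ ⋀[R]^l.length M := by
  induction l with
  | nil => simp [ExteriorAlgebra.exteriorPower]
  | cons v l ih => exact ι_mul_mem_exteriorPower v ih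

end Contraction

section Koszul

variable {R ι : Type*} [CommRing R] [Fintype ι] [DecidableEq ι]

/-- The subalgebra of the exterior algebra of `R^ι` generated by the basis vectors in `S`,
characterized as the common kernel of the contractions by the other coordinates. -/
def coordExterior (R : Type*) {ι : Type*} [CommRing R] (S : Finset ι) :
    Submodule R (ExteriorAlgebra R (ι → R)) :=
  ⨅ j ∈ {j | j ∉ S}, LinearMap.ker (contraction (LinearMap.proj j))

theorem mem_coordExterior {S : Finset ι} {z : ExteriorAlgebra R (ι → R)} :
    z ∈ coordExterior R S ↔ ∀ j ∉ S, contraction (LinearMap.proj j) z = 0 := by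
  simp [coordExterior]

/-- The Koszul complex on the values of `f` at the basis vectors in `S` is exact in all degrees
above `s`. -/
def KoszulExactAbove (f : Module.Dual R (ι → R)) (S : Finset ι) (s : ℕ) : Prop :=
  ∀ i > s, ∀ z ∈ coordExterior R S, z ∈ ⋀[R]^i (ι → R) → contraction f z = 0 →
    ∃ w ∈ coordExterior R S, w ∈ ⋀[R]^(i + 1) (ι → R) ∧ contraction f w = z

theorem sum_smul_ι_single (v : ι → R) :
    ∑ j, v j • ExteriorAlgebra.ι R (Pi.single j 1 : ι → R) = ExteriorAlgebra.ι R v := by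
  conv_rhs => rw [← Finset.univ_sum_single v]
  rw [map_sum]
  refine Finset.sum_congr rfl fun j _ => ?_
  rw [← map_smul, ← Pi.single_smul, smul_eq_mul, mul_one]

theorem ι_single_mul_contraction_ι_mul (v : ι → R) (z : ExteriorAlgebra R (ι → R)) (j : ι) :
    ExteriorAlgebra.ι R (Pi.single j 1 : ι → R) *
        contraction (LinearMap.proj j) (ExteriorAlgebra.ι R v * z) =
      (v j • ExteriorAlgebra.ι R (Pi.single j 1 : ι → R)) * z + ExteriorAlgebra.ι R v *
        (ExteriorAlgebra.ι R (Pi.single j 1 : ι → R) * contraction (LinearMap.proj j) z) := by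
  rw [contraction_ι_mul, mul_sub, mul_smul_comm, smul_mul_assoc, LinearMap.proj_apply,
    ← mul_assoc, ← mul_assoc, sub_eq_add_neg, ← neg_mul,
    neg_eq_of_add_eq_zero_right (ExteriorAlgebra.ι_add_mul_swap _ _)]

/-- The number operator: it multiplies the elements of degree `i` by `i`. -/
theorem sum_ι_mul_contraction {i : ℕ} {z : ExteriorAlgebra R (ι → R)}
    (hz : z ∈ ⋀[R]^i (ι → R)) :
    ∑ j, ExteriorAlgebra.ι R (Pi.single j 1 : ι → R) * contraction (LinearMap.proj j) z =
      i • z := by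
  induction i generalizing z with
  | zero =>
    rw [ExteriorAlgebra.exteriorPower, pow_zero] at hz
    obtain ⟨r, rfl⟩ := Submodule.mem_one.1 hz
    simp [contraction_algebraMap]
  | succ i ih =>
    have key : ∀ (v : ι → R), ∀ z ∈ ⋀[R]^i (ι → R),
        ∑ j, ExteriorAlgebra.ι R (Pi.single j 1 : ι → R) *
          contraction (LinearMap.proj j) (ExteriorAlgebra.ι R v * z) =
        (i + 1) • (ExteriorAlgebra.ι R v * z) := by
      intro v z hz
      simp only [ι_single_mul_contraction_ι_mul, Finset.sum_add_distrib, ← Finset.sum_mul,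
        ← Finset.mul_sum, sum_smul_ι_single, ih hz]
      rw [add_smul, one_smul, mul_smul_comm, add_comm]
    refine exteriorPower_succ_induction (R := R) (M := ι → R) (p := fun z => ∑ j, ExteriorAlgebra.ι R
      (Pi.single j 1 : ι → R) * contraction (LinearMap.proj j) z = (i + 1) • z) key
      (fun z w hz hw => ?_) hz
    simp only [map_add, mul_add, Finset.sum_add_distrib, hz, hw, smul_add]

/-- Over the rationals an element of positive degree that all contractions annihilate is zero,
because the number operator is invertible on it. -/
theorem koszulExactAbove_empty [Algebra ℚ R] (f : Module.Dual R (ι → R)) :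
    KoszulExactAbove f ∅ 0 := by
  intro i hi z hz hzi _
  have h1 := sum_ι_mul_contraction hzi
  rw [mem_coordExterior] at hz
  simp only [hz _ (Finset.notMem_empty _), mul_zero, Finset.sum_const_zero] at h1
  have hu : IsUnit (i : R) := by
    have : ((i : R)) = algebraMap ℚ R i := by simp
    rw [this]
    exact (IsUnit.mk0 (i : ℚ) (by exact_mod_cast hi.ne')).map _
  rw [← Nat.cast_smul_eq_nsmul R, eq_comm, hu.smul_eq_zero] at h1
  exact ⟨0, zero_mem _, zero_mem _, by rw [h1, map_zero]⟩

theorem coordExterior_mono {S T : Finset ι} (h : S ⊆ T) : coordExterior R S ≤ coordExterior R T :=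
  fun _ hz => mem_coordExterior.2 fun j hj => mem_coordExterior.1 hz j fun hjS => hj (h hjS)

theorem ι_single_mul_mem_coordExterior {S : Finset ι} {j : ι} (hj : j ∈ S)
    {z : ExteriorAlgebra R (ι → R)} (hz : z ∈ coordExterior R S) :
    ExteriorAlgebra.ι R (Pi.single j 1 : ι → R) * z ∈ coordExterior R S :=
  mem_coordExterior.2 fun k hk => by
    have hkj : k ≠ j := fun h => hk (h ▸ hj)
    rw [contraction_ι_mul, mem_coordExterior.1 hz k hk, LinearMap.proj_apply,
      Pi.single_eq_of_ne hkj, zero_smul, mul_zero, sub_zero]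

theorem contraction_proj_mem_coordExterior {S : Finset ι} {j : ι}
    {z : ExteriorAlgebra R (ι → R)} (hz : z ∈ coordExterior R (insert j S)) :
    contraction (LinearMap.proj j) z ∈ coordExterior R S :=
  mem_coordExterior.2 fun k hk => by
    by_cases hkj : k = j
    · rw [hkj, contraction_contraction]
    · rw [contraction_comm, mem_coordExterior.1 hz k (by simp [hk, hkj]), map_zero, neg_zero]

theorem sub_ι_mul_contraction_mem {S : Finset ι} {j : ι}
    {z : ExteriorAlgebra R (ι → R)} (hz : z ∈ coordExterior R (insert j S)) :
    z - ExteriorAlgebra.ι R (Pi.single j 1 : ι → R) * contraction (LinearMap.proj j) z ∈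
      coordExterior R S :=
  mem_coordExterior.2 fun k hk => by
    rw [map_sub, contraction_ι_mul]
    by_cases hkj : k = j
    · subst hkj
      simp [contraction_contraction]
    · rw [mem_coordExterior.1 hz k (by simp [hk, hkj]), contraction_comm,
        mem_coordExterior.1 hz k (by simp [hk, hkj]), LinearMap.proj_apply,
        Pi.single_eq_of_ne hkj]
      simp

/-- The step of the induction on `S`: a cycle `z` for `insert j S` is a boundary as soon as its
contraction by the `j`-th coordinate is one. -/
theorem KoszulExactAbove.exists_of_contraction {f : Module.Dual R (ι → R)} {S : Finset ι} {s : ℕ}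
    (hS : KoszulExactAbove f S s) {j : ι} {i : ℕ} (hi : i > s)
    {z w : ExteriorAlgebra R (ι → R)} (hz : z ∈ coordExterior R (insert j S))
    (hzi : z ∈ ⋀[R]^i (ι → R)) (hfz : contraction f z = 0) (hw : w ∈ coordExterior R S)
    (hwi : w ∈ ⋀[R]^i (ι → R)) (hfw : contraction f w = contraction (LinearMap.proj j) z) :
    ∃ u ∈ coordExterior R (insert j S), u ∈ ⋀[R]^(i + 1) (ι → R) ∧ contraction f u = z := by
  have hins : S ⊆ insert j S := Finset.subset_insert _ _
  set e := ExteriorAlgebra.ι R (Pi.single j 1 : ι → R) with he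
  have h1 : z + contraction f (e * w) =
      z - e * contraction (LinearMap.proj j) z + f (Pi.single j 1) • w := by
    rw [contraction_ι_mul, hfw]
    abel
  have hew := ι_mul_mem_exteriorPower (Pi.single j 1 : ι → R) hwi
  obtain ⟨u, hu, hui, hfu⟩ := hS i hi (z + contraction f (e * w))
    (by
      rw [h1]
      exact add_mem (sub_ι_mul_contraction_mem hz) (Submodule.smul_mem _ _ hw))
    (add_mem hzi (contraction_mem_exteriorPower f hew))
    (by rw [map_add, hfz, contraction_contraction, add_zero])
  refine ⟨u - e * w, sub_mem (coordExterior_mono hins hu)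
    (ι_single_mul_mem_coordExterior (Finset.mem_insert_self _ _) (coordExterior_mono hins hw)),
    sub_mem hui hew, ?_⟩
  rw [map_sub, hfu, add_sub_cancel_right]

/-- Adding an arbitrary element costs at most one degree of exactness. -/
theorem KoszulExactAbove.insert_succ {f : Module.Dual R (ι → R)} {S : Finset ι} {s : ℕ}
    (hS : KoszulExactAbove f S s) (j : ι) : KoszulExactAbove f (insert j S) (s + 1) := by
  intro i hi z hz hzi hfz
  obtain ⟨i, rfl⟩ : ∃ m, i = m + 1 := ⟨i - 1, by omega⟩
  obtain ⟨w, hw, hwi, hfw⟩ := hS i (by omega) _ (contraction_proj_mem_coordExterior hz)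
    (contraction_mem_exteriorPower _ hzi) (by rw [contraction_comm, hfz, map_zero, neg_zero])
  exact hS.exists_of_contraction (by omega) hz hzi hfz hw hwi hfw

/-- Adding an element that is regular modulo the previous ones preserves exactness in positive
degrees. -/
theorem KoszulExactAbove.insert_regular {f : Module.Dual R (ι → R)} {S : Finset ι}
    (hS : KoszulExactAbove f S 0) (j : ι)
    (hj : ∀ y, f (Pi.single j 1) * y ∈ Ideal.span ((fun k => f (Pi.single k 1)) '' S) →
      y ∈ Ideal.span ((fun k => f (Pi.single k 1)) '' S)) :
    KoszulExactAbove f (insert j S) 0 := by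
  intro i hi z hz hzi hfz
  obtain ⟨i, rfl⟩ : ∃ m, i = m + 1 := ⟨i - 1, by omega⟩
  rcases Nat.eq_zero_or_pos i with rfl | hi'
  -- in degree one the cycle is a relation, whose coefficient `r` at `j` lies in the ideal of the
  -- previous elements by regularity
  · have hy := contraction_mem_exteriorPower (LinearMap.proj j) hzi
    rw [ExteriorAlgebra.exteriorPower, pow_zero] at hy
    obtain ⟨r, hr⟩ := Submodule.mem_one.1 hy
    have hx := sub_ι_mul_contraction_mem hz
    have hx1 : z - ExteriorAlgebra.ι R (Pi.single j 1 : ι → R) * contraction (LinearMap.proj j) z ∈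
        ⋀[R]^1 (ι → R) :=
      sub_mem hzi (ι_mul_mem_exteriorPower _ (contraction_mem_exteriorPower _ hzi))
    rw [ExteriorAlgebra.exteriorPower, pow_one] at hx1
    obtain ⟨v, hv⟩ := hx1
    rw [← hv] at hx
    have hvS : ∀ k ∉ S, v k = 0 := by
      intro k hk
      have := mem_coordExterior.1 hx k hk
      rwa [contraction_ι, LinearMap.proj_apply, ExteriorAlgebra.algebraMap_eq_zero_iff] at this
    have hfv : f v = -(f (Pi.single j 1) * r) := by
      have h2 := congrArg (contraction f) hv
      rw [contraction_ι, map_sub, hfz, contraction_ι_mul, ← hr, contraction_algebraMap, mul_zero,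
        sub_zero, zero_sub, Algebra.smul_def, ← map_mul, ← map_neg,
        ExteriorAlgebra.algebraMap_inj] at h2
      exact h2
    have hf : ∀ u : ι → R, (∀ k ∉ S, u k = 0) → f u = ∑ k ∈ S, u k * f (Pi.single k 1) := by
      intro u hu
      conv_lhs => rw [← Finset.univ_sum_single u]
      rw [map_sum, ← Finset.sum_subset (Finset.subset_univ S)]
      · refine Finset.sum_congr rfl fun k _ => ?_
        rw [← smul_eq_mul, ← map_smul, ← Pi.single_smul, smul_eq_mul, mul_one]
      · intro k _ hk
        rw [hu k hk, Pi.single_zero, map_zero]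
    have hr' := hj r (by
      rw [← neg_neg (f (Pi.single j 1) * r), ← hfv, hf v hvS]
      refine neg_mem (Submodule.sum_mem _ fun k hk => Ideal.mul_mem_left _ _ ?_)
      exact Ideal.subset_span ⟨k, hk, rfl⟩)
    obtain ⟨c, hc⟩ := (Submodule.mem_span_image_finset_iff_exists_fun R).1 hr'
    let u : ι → R := fun k => if h : k ∈ S then c ⟨k, h⟩ else 0
    have hu : ∀ k ∉ S, u k = 0 := fun k hk => dif_neg hk
    refine hS.exists_of_contraction one_pos hz hzi hfz (w := ExteriorAlgebra.ι R u) ?_ ?_ ?_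
    · refine mem_coordExterior.2 fun k hk => ?_
      rw [contraction_ι, LinearMap.proj_apply, hu k hk, map_zero]
    · rw [ExteriorAlgebra.exteriorPower, pow_one]
      exact ⟨u, rfl⟩
    · rw [contraction_ι, ← hr, hf u hu, ← hc]
      congr 1
      rw [← Finset.sum_coe_sort S]
      refine Finset.sum_congr rfl fun k _ => ?_
      rw [show u k = c k from dif_pos k.2, smul_eq_mul]
  · obtain ⟨w, hw, hwi, hfw⟩ := hS i hi' _ (contraction_proj_mem_coordExterior hz)
      (contraction_mem_exteriorPower _ hzi) (by rw [contraction_comm, hfz, map_zero, neg_zero])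
    exact hS.exists_of_contraction (by omega) hz hzi hfz hw hwi hfw

end Koszul

end FJRW

/-! ### Syzygies of a sequence whose ideal contains a regular sequence -/

namespace FJRW

section Syzygies

variable {R κ : Type*} [CommRing R] [Fintype κ] [DecidableEq κ]

/-- The Koszul complex on a sequence `a`, regular in every order, followed by an arbitrary
sequence `b` of the same length has no homology in degrees above that length. -/
theorem koszulExactAbove_sum [Algebra ℚ R] (a : κ → R)
    (ha : ∀ (S : Finset κ), ∀ j ∉ S, ∀ y, a j * y ∈ Ideal.span (a '' S) → y ∈ Ideal.span (a '' S))
    (f : Module.Dual R (κ ⊕ κ → R)) (hf : ∀ j, f (Pi.single (Sum.inl j) 1) = a j) :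
    KoszulExactAbove f Finset.univ (Fintype.card κ) := by
  have h1 : ∀ S : Finset κ, KoszulExactAbove f (S.image Sum.inl) 0 := by
    intro S
    induction S using Finset.induction_on with
    | empty => simpa using koszulExactAbove_empty f
    | insert j S hj ih =>
      rw [Finset.image_insert]
      refine ih.insert_regular _ ?_
      have : (fun k => f (Pi.single k 1)) '' ((S.image Sum.inl : Finset (κ ⊕ κ)) : Set (κ ⊕ κ)) =
          a '' S := by
        rw [Finset.coe_image, Set.image_image]
        simp only [hf]
      rw [this, hf]
      exact ha S j hj
  have h2 : ∀ S : Finset κ,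
      KoszulExactAbove f (S.image Sum.inr ∪ Finset.univ.image Sum.inl) S.card := by
    intro S
    induction S using Finset.induction_on with
    | empty => simpa using h1 Finset.univ
    | insert j S hj ih =>
      rw [Finset.image_insert, Finset.insert_union, Finset.card_insert_of_notMem hj]
      exact ih.insert_succ _
  have h3 := h2 Finset.univ
  have h4 : (Finset.univ.image Sum.inr ∪ Finset.univ.image Sum.inl : Finset (κ ⊕ κ)) =
      Finset.univ := by
    ext x
    rcases x with x | x <;> simp
  rwa [h4] at h3

/-- Successive contractions by the coordinates in a list. -/
def iterContraction {ι : Type*} : List ι → ExteriorAlgebra R (ι → R) → ExteriorAlgebra R (ι → R)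
  | [], z => z
  | j :: l, z => iterContraction l (contraction (LinearMap.proj j) z)

theorem exists_iterContraction_contraction {ι : Type*} (f : Module.Dual R (ι → R)) (l : List ι)
    (w : ExteriorAlgebra R (ι → R)) :
    ∃ w', iterContraction l (contraction f w) = contraction f w' := by
  induction l generalizing w with
  | nil => exact ⟨w, rfl⟩
  | cons j l ih =>
    obtain ⟨w', hw'⟩ := ih (-contraction (LinearMap.proj j) w)
    refine ⟨w', ?_⟩
    rw [iterContraction, contraction_comm, ← map_neg, hw']

theorem iterContraction_prod {ι : Type*} (u : κ → ι → R) (g : κ → ι) (v : ι → R) (l : List κ)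
    (hl : l.Nodup) (hu : ∀ i ∈ l, ∀ j ∈ l, u j (g i) = if i = j then 1 else 0)
    (hv : ∀ i ∈ l, v (g i) = 0) :
    iterContraction (l.map g) ((l.map u ++ [v]).map (ExteriorAlgebra.ι R)).prod =
      ExteriorAlgebra.ι R v := by
  induction l with
  | nil => simp [iterContraction]
  | cons j l ih =>
    rw [List.nodup_cons] at hl
    rw [List.map_cons, List.map_cons, List.cons_append, List.map_cons, List.prod_cons,
      iterContraction, contraction_ι_mul, contraction_prod_ι, LinearMap.proj_apply,
      hu j (by simp) j (by simp), if_pos rfl, one_smul, mul_zero, sub_zero]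
    · exact ih hl.2 (fun i hi k hk => hu i (by simp [hi]) k (by simp [hk]))
        fun i hi => hv i (by simp [hi])
    · intro w hw
      rw [List.mem_append, List.mem_map, List.mem_singleton] at hw
      rcases hw with ⟨k, hk, rfl⟩ | rfl
      · rw [LinearMap.proj_apply, hu j (by simp) k (by simp [hk]),
          if_neg (by rintro rfl; exact hl.1 hk)]
      · exact hv j (by simp)

/-- If the ideal of `b` contains a regular sequence `a` of the same length, then every relation
between the entries of `b` is a consequence of the relations `b i * b j = b j * b i`. The sequence
`b` need not be regular in the given order: the Koszul complex on `a` and `b` together computes, up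
to a change of basis, the one on `b` and zeros. -/
theorem exists_koszul_syzygy [Algebra ℚ R] (a b c : κ → R)
    (ha : ∀ (S : Finset κ), ∀ j ∉ S, ∀ y, a j * y ∈ Ideal.span (a '' S) → y ∈ Ideal.span (a '' S))
    (hab : ∀ j, a j ∈ Ideal.span (Set.range b)) (hc : ∑ i, c i * b i = 0) :
    ∃ e : κ → κ → R, (∀ i j, e i j = -e j i) ∧ ∀ i, c i = ∑ j, b j * e i j := by
  have hC : ∀ j, ∃ r : κ → R, ∑ k, r k * b k = a j := fun j =>
    (Ideal.mem_span_range_iff_exists_fun).1 (hab j)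
  choose C hC using hC
  -- `f` is the linear form with values `a`, `b` on the basis; the `ψ k` and the first half of the
  -- coordinates form a dual basis in which `f` has only the entries of `b`
  let ψ : κ → Module.Dual R (κ ⊕ κ → R) := fun k =>
    LinearMap.proj (Sum.inr k) + ∑ j, C j k • LinearMap.proj (Sum.inl j)
  let f : Module.Dual R (κ ⊕ κ → R) := ∑ k, b k • ψ k
  have hψ : ∀ k v, ψ k v = v (Sum.inr k) + ∑ j, C j k * v (Sum.inl j) := by
    intro k v
    simp [ψ]
  have hf : ∀ v, f v = ∑ k, b k * ψ k v := by
    intro v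
    simp [f]
  have hfa : ∀ j, f (Pi.single (Sum.inl j) 1) = a j := by
    intro j
    rw [hf, ← hC j]
    refine Finset.sum_congr rfl fun k _ => ?_
    rw [hψ, Finset.sum_eq_single j]
    · simp [mul_comm]
    · intro i _ hij
      simp [hij]
    · simp
  let u : κ → κ ⊕ κ → R := fun j => Sum.elim (Pi.single j 1) fun k => -C j k
  have hψu : ∀ k j, ψ k (u j) = 0 := by
    intro k j
    rw [hψ, Finset.sum_eq_single j]
    · simp [u]
    · intro i _ hij
      simp [u, Pi.single_eq_of_ne hij]
    · simp
  have hfu : ∀ j, f (u j) = 0 := fun j => by simp [hf, hψu]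
  let v : κ ⊕ κ → R := Sum.elim 0 c
  have hψv : ∀ k, ψ k v = c k := by
    intro k
    simp [hψ, v]
  have hfv : f v = 0 := by
    rw [hf, ← hc]
    exact Finset.sum_congr rfl fun k _ => by rw [hψv, mul_comm]
  let L : List κ := Finset.univ.toList
  -- the vectors `u j` span the common kernel of the `ψ k`, so the product of all of them with the
  -- relation `v` is a cycle; it has degree `card κ + 1` and is therefore a boundary, and
  -- contracting it by the first half of the coordinates recovers `v`
  let z := ((L.map u ++ [v]).map (ExteriorAlgebra.ι R)).prod
  obtain ⟨w, -, -, hw⟩ := koszulExactAbove_sum a ha f hfa (Fintype.card κ + 1) (by omega) z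
    (mem_coordExterior.2 fun j hj => absurd (Finset.mem_univ j) hj)
    (by
      have := prod_ι_mem_exteriorPower (R := R) (L.map u ++ [v])
      rwa [List.length_append, List.length_map, Finset.length_toList, Finset.card_univ] at this)
    (contraction_prod_ι f _ fun x hx => by
      rw [List.mem_append, List.mem_map, List.mem_singleton] at hx
      rcases hx with ⟨k, _, rfl⟩ | rfl
      exacts [hfu k, hfv])
  obtain ⟨w', hw'⟩ := exists_iterContraction_contraction f (L.map Sum.inl) w
  rw [hw, iterContraction_prod u Sum.inl v L (Finset.nodup_toList _)
    (fun i _ j _ => by simp [u, Pi.single_apply]) (fun i _ => by simp [v])] at hw'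
  have hfw : contraction f w' = ∑ k, b k • contraction (ψ k) w' := by
    simp only [contraction, f, map_sum, map_smul, LinearMap.sum_apply, LinearMap.smul_apply]
  refine ⟨fun i j => ExteriorAlgebra.algebraMapInv (contraction (ψ i) (contraction (ψ j) w')),
    fun i j => ?_, fun i => ?_⟩
  · rw [← map_neg, ← contraction_comm]
  · have h1 := congrArg (fun z => ExteriorAlgebra.algebraMapInv (contraction (ψ i) z)) hw'
    simp only [contraction_ι, hψv, hfw, map_sum, map_smul, smul_eq_mul] at h1
    rw [← h1, ExteriorAlgebra.algebraMap_leftInverse]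

end Syzygies

end FJRW

/-! ### Homogeneous syzygies -/

namespace FJRW

open MvPolynomial

section Graded

variable {σ κ Γ : Type*} [Fintype σ] [AddCommGroup Γ] {w : σ → Γ}

theorem weightedHomogeneousComponent_mul {b : MvPolynomial σ ℂ} {d : Γ}
    (hb : IsWeightedHomogeneous w b d) (e : MvPolynomial σ ℂ) (γ : Γ) :
    weightedHomogeneousComponent w γ (b * e) =
      b * weightedHomogeneousComponent w (γ - d) e := by
  classical
  let := weightedGradedAlgebra ℂ w
  have h := DirectSum.coe_decompose_mul_add_of_left_mem (weightedHomogeneousSubmodule ℂ w)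
    (j := γ - d) (b := e) (show b ∈ weightedHomogeneousSubmodule ℂ w d from hb)
  rw [add_sub_cancel] at h
  rw [← weightedDecomposition.decompose'_apply, ← weightedDecomposition.decompose'_apply]
  exact h

variable (deg : Γ →+ ℝ)

theorem deg_weight (a : σ →₀ ℕ) : deg (Finsupp.weight w a) = ∑ i, (a i : ℝ) * deg (w i) := by
  rw [Finsupp.weight_apply, Finsupp.sum_fintype _ _ (by simp), map_sum]
  simp

variable (hw : ∀ i, 0 < deg (w i))

include hw

theorem eq_zero_of_deg_neg {p : MvPolynomial σ ℂ} {γ : Γ} (hp : IsWeightedHomogeneous w p γ)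
    (hγ : deg γ < 0) : p = 0 := by
  ext a
  rw [coeff_zero]
  by_contra ha
  have h := deg_weight (w := w) deg a
  rw [hp ha] at h
  have : 0 ≤ ∑ i, (a i : ℝ) * deg (w i) :=
    Finset.sum_nonneg fun i _ => mul_nonneg (Nat.cast_nonneg _) (hw i).le
  linarith

theorem finite_weightedHomogeneousSubmodule (γ : Γ) :
    FiniteDimensional ℂ (weightedHomogeneousSubmodule ℂ w γ) := by
  classical
  have hfin : {a : σ →₀ ℕ | Finsupp.weight w a = γ}.Finite := by
    let B : σ →₀ ℕ := Finsupp.equivFunOnFinite.symm fun i => ⌈deg γ / deg (w i)⌉₊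
    refine (Set.finite_Icc 0 B).subset fun a ha => ⟨zero_le, fun i => ?_⟩
    have h := deg_weight (w := w) deg a
    rw [show Finsupp.weight w a = γ from ha] at h
    have h1 : (a i : ℝ) * deg (w i) ≤ deg γ := by
      rw [h]
      exact Finset.single_le_sum (f := fun i => (a i : ℝ) * deg (w i))
        (fun i _ => mul_nonneg (Nat.cast_nonneg _) (hw i).le) (Finset.mem_univ i)
    have h2 : (a i : ℝ) ≤ deg γ / deg (w i) := (le_div_iff₀ (hw i)).2 h1
    exact_mod_cast h2.trans (Nat.le_ceil _)
  rw [weightedHomogeneousSubmodule_eq_finsupp_supported]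
  have := hfin.to_subtype
  exact Module.Finite.of_basis (basisRestrictSupport ℂ {a | Finsupp.weight w a = γ})

omit hw

/-- Every homogeneous relation between the `b i`, `i ∈ S`, is a combination of the relations
`b i * b j = b j * b i`, with homogeneous coefficients. -/
def HomogeneousKoszulSyzygies (w : σ → Γ) (b : κ → MvPolynomial σ ℂ) (d : κ → Γ) (S : Finset κ) :
    Prop :=
  ∀ (γ : Γ) (c : κ → MvPolynomial σ ℂ), (∀ i, IsWeightedHomogeneous w (c i) (γ - d i)) →
    ∑ i ∈ S, c i * b i = 0 → ∃ e : κ → κ → MvPolynomial σ ℂ, (∀ i j, e i j = -e j i) ∧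
      (∀ i j, IsWeightedHomogeneous w (e i j) (γ - d i - d j)) ∧
      ∀ i ∈ S, c i = ∑ j ∈ S, b j * e i j

theorem self_eq_zero_of_antisymm {e : κ → κ → MvPolynomial σ ℂ} (he : ∀ i j, e i j = -e j i)
    (k : κ) : e k k = 0 := self_eq_neg.1 (he k k)

variable {b : κ → MvPolynomial σ ℂ} {d : κ → Γ} (hb : ∀ k, IsWeightedHomogeneous w (b k) (d k))

include hb

/-- The relations of a homogeneous sequence are Koszul relations when its ideal contains a regular
sequence of the same length. -/
theorem homogeneousKoszulSyzygies_univ [Fintype κ] [DecidableEq κ] (a : κ → MvPolynomial σ ℂ)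
    (ha : ∀ (S : Finset κ), ∀ j ∉ S, ∀ y, a j * y ∈ Ideal.span (a '' S) → y ∈ Ideal.span (a '' S))
    (hab : ∀ j, a j ∈ Ideal.span (Set.range b)) :
    HomogeneousKoszulSyzygies w b d Finset.univ := by
  intro γ c hc hcb
  obtain ⟨e, he, hce⟩ := exists_koszul_syzygy a b c ha hab hcb
  refine ⟨fun i j => weightedHomogeneousComponent w (γ - d i - d j) (e i j), fun i j => ?_,
    fun i j => weightedHomogeneousComponent_mem w _ _, fun i _ => ?_⟩
  · dsimp only
    rw [he i j, map_neg, sub_right_comm]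
  · rw [← (hc i).weightedHomogeneousComponent_same, hce i, map_sum]
    exact Finset.sum_congr rfl fun j _ => weightedHomogeneousComponent_mul (hb j) _ _

include hw

/-- In the graded setting the property passes to subsequences, as regularity does. -/
theorem HomogeneousKoszulSyzygies.of_insert [DecidableEq κ] (hd : ∀ k, 0 < deg (d k))
    {S : Finset κ} {k : κ} (hk : k ∉ S) (h : HomogeneousKoszulSyzygies w b d (insert k S)) :
    HomogeneousKoszulSyzygies w b d S := by
  -- the coefficient of the relation at `k` is a relation of smaller degree: descent on the degree
  have main : ∀ (N : ℕ) (γ : Γ), deg γ < N * deg (d k) → ∀ c : κ → MvPolynomial σ ℂ,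
      (∀ i, IsWeightedHomogeneous w (c i) (γ - d i)) → ∑ i ∈ S, c i * b i = 0 →
      ∃ e : κ → κ → MvPolynomial σ ℂ, (∀ i j, e i j = -e j i) ∧
      (∀ i j, IsWeightedHomogeneous w (e i j) (γ - d i - d j)) ∧
      ∀ i ∈ S, c i = ∑ j ∈ S, b j * e i j := by
    intro N
    induction N with
    | zero =>
      intro γ hγ c hc _
      refine ⟨fun _ _ => 0, by simp, fun i j => isWeightedHomogeneous_zero _ _ _, fun i _ => ?_⟩
      rw [eq_zero_of_deg_neg deg hw (hc i)]
      · simp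
      · rw [map_sub]
        have := hd i
        rw [Nat.cast_zero, zero_mul] at hγ
        linarith
    | succ N ih =>
      intro γ hγ c hc hcb
      have hne : ∀ i ∈ S, i ≠ k := fun i hi hik => hk (hik ▸ hi)
      obtain ⟨e, he, hed, hce⟩ := h γ (Function.update c k 0) (fun i => by
          by_cases hik : i = k
          · subst hik
            simpa using isWeightedHomogeneous_zero _ _ _
          · simpa [hik] using hc i) (by
          rw [Finset.sum_insert hk, Function.update_self, zero_mul, zero_add, ← hcb]
          exact Finset.sum_congr rfl fun i hi => by rw [Function.update_of_ne (hne i hi)])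
      have hkk := hce k (Finset.mem_insert_self _ _)
      rw [Function.update_self, Finset.sum_insert hk, self_eq_zero_of_antisymm he k, mul_zero,
        zero_add] at hkk
      obtain ⟨ε, hε, hεd, hcε⟩ := ih (γ - d k) (by
        rw [map_sub]
        push_cast at hγ
        linarith) (fun j => e k j) (fun j => hed k j) (by
        rw [hkk]
        exact Finset.sum_congr rfl fun i _ => mul_comm _ _)
      refine ⟨fun i j => e i j - b k * ε i j, fun i j => ?_, fun i j => ?_, fun i hi => ?_⟩
      · dsimp only
        rw [he i j, hε i j]
        ring
      · refine (hed i j).sub ?_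
        have := (hb k).mul (hεd i j)
        rwa [show d k + (γ - d k - d i - d j) = γ - d i - d j by abel] at this
      · have h1 := hce i (Finset.mem_insert_of_mem hi)
        rw [Function.update_of_ne (hne i hi), Finset.sum_insert hk, he i k, hcε i hi] at h1
        rw [h1]
        simp only [mul_sub, Finset.sum_sub_distrib, mul_neg, Finset.mul_sum]
        rw [sub_eq_neg_add]
        congr 2
        exact Finset.sum_congr rfl fun j _ => by ring
  intro γ
  obtain ⟨N, hN⟩ := exists_nat_gt (deg γ / deg (d k))
  exact main N γ ((div_lt_iff₀ (hd k)).1 hN)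

theorem HomogeneousKoszulSyzygies.mono [DecidableEq κ] (hd : ∀ k, 0 < deg (d k))
    {S T : Finset κ} (hST : S ⊆ T) (h : HomogeneousKoszulSyzygies w b d T) :
    HomogeneousKoszulSyzygies w b d S := by
  have main : ∀ U : Finset κ, Disjoint S U → HomogeneousKoszulSyzygies w b d (S ∪ U) →
      HomogeneousKoszulSyzygies w b d S := by
    intro U
    induction U using Finset.induction_on with
    | empty => intro _ h; simpa using h
    | insert k U hk ih =>
      intro hdis h
      rw [Finset.disjoint_insert_right] at hdis
      rw [Finset.union_insert] at h
      exact ih hdis.2 (h.of_insert deg hw hb hd (by simp [hdis.1, hk]))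
  exact main (T \ S) Finset.disjoint_sdiff (by rwa [Finset.union_sdiff_of_subset hST])

omit hw

theorem exists_homogeneous_of_mem_span {S : Finset κ} {p : MvPolynomial σ ℂ} {γ : Γ}
    (hp : IsWeightedHomogeneous w p γ) (hpS : p ∈ Ideal.span (b '' S)) :
    ∃ c : κ → MvPolynomial σ ℂ, (∀ i, IsWeightedHomogeneous w (c i) (γ - d i)) ∧
      p = ∑ i ∈ S, b i * c i := by
  classical
  obtain ⟨c, hc⟩ := (Submodule.mem_span_image_finset_iff_exists_fun _).1 hpS
  refine ⟨fun i => weightedHomogeneousComponent w (γ - d i)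
    (if h : i ∈ S then c ⟨i, h⟩ else 0), fun i =>
    weightedHomogeneousComponent_mem w _ _, ?_⟩
  rw [← hp.weightedHomogeneousComponent_same, ← hc, map_sum, ← Finset.sum_coe_sort S]
  refine Finset.sum_congr rfl fun i _ => ?_
  dsimp only
  rw [dif_pos i.2, smul_eq_mul, mul_comm, weightedHomogeneousComponent_mul (hb i)]

/-- Homogeneous elements form a regular sequence when their relations are the obvious ones. -/
theorem HomogeneousKoszulSyzygies.mem_span_of_mul_mem [DecidableEq κ]
    {S : Finset κ} {k : κ} (hk : k ∉ S) (h : HomogeneousKoszulSyzygies w b d (insert k S))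
    {y : MvPolynomial σ ℂ} {γ : Γ} (hy : IsWeightedHomogeneous w y γ)
    (hyS : b k * y ∈ Ideal.span (b '' S)) : y ∈ Ideal.span (b '' S) := by
  obtain ⟨c, hc, hcb⟩ := exists_homogeneous_of_mem_span hb ((hb k).mul hy) hyS
  have hne : ∀ i ∈ S, i ≠ k := fun i hi hik => hk (hik ▸ hi)
  obtain ⟨e, he, -, hce⟩ := h (d k + γ) (Function.update (-c) k y) (fun i => by
      by_cases hik : i = k
      · subst hik
        simpa using hy
      · simpa [hik] using (hc i).neg) (by
      rw [Finset.sum_insert hk, Function.update_self, mul_comm, hcb, ← Finset.sum_add_distrib]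
      refine Finset.sum_eq_zero fun i hi => ?_
      rw [Function.update_of_ne (hne i hi), Pi.neg_apply]
      ring)
  have hkk := hce k (Finset.mem_insert_self _ _)
  rw [Function.update_self, Finset.sum_insert hk, self_eq_zero_of_antisymm he k, mul_zero,
    zero_add] at hkk
  rw [hkk]
  exact Submodule.sum_mem _ fun j hj =>
    Ideal.mul_mem_right _ _ (Ideal.subset_span ⟨j, hj, rfl⟩)

end Graded

end FJRW

/-! ### Dimensions of the graded pieces of a complete intersection -/

namespace FJRW

open MvPolynomial

section Dimensions

variable {σ κ Γ : Type*} [Fintype σ] [AddCommGroup Γ] {w : σ → Γ}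

/-- The part of degree `γ` of an ideal. -/
def gradedPiece (w : σ → Γ) (I : Ideal (MvPolynomial σ ℂ)) (γ : Γ) :
    Submodule ℂ (MvPolynomial σ ℂ) :=
  I.restrictScalars ℂ ⊓ weightedHomogeneousSubmodule ℂ w γ

variable (deg : Γ →+ ℝ) (hw : ∀ i, 0 < deg (w i)) {b : κ → MvPolynomial σ ℂ} {d : κ → Γ}
  (hb : ∀ k, IsWeightedHomogeneous w (b k) (d k))

include hb

theorem gradedPiece_insert [DecidableEq κ] (S : Finset κ) {k : κ} (hk : k ∉ S) (γ : Γ) :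
    gradedPiece w (Ideal.span (b '' (insert k S : Finset κ))) γ =
      gradedPiece w (Ideal.span (b '' S)) γ ⊔
        (weightedHomogeneousSubmodule ℂ w (γ - d k)).map (LinearMap.mulLeft ℂ (b k)) := by
  apply le_antisymm
  · rintro p ⟨hp1, hp2⟩
    obtain ⟨c, hc, rfl⟩ := exists_homogeneous_of_mem_span hb hp2 hp1
    rw [Finset.sum_insert hk, add_comm]
    refine Submodule.add_mem_sup ⟨?_, ?_⟩ ⟨c k, hc k, rfl⟩
    · exact Submodule.sum_mem (p := Ideal.span (b '' S)) fun i hi =>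
        Ideal.mul_mem_right _ _ (Ideal.subset_span ⟨i, hi, rfl⟩)
    · refine Submodule.sum_mem _ fun i _ => ?_
      have := (hb i).mul (hc i)
      rwa [add_sub_cancel] at this
  · refine sup_le (fun p hp => ⟨Ideal.span_mono (Set.image_mono (by simp)) hp.1, hp.2⟩) ?_
    rintro _ ⟨c, hc, rfl⟩
    refine ⟨Ideal.mul_mem_right _ _ (Ideal.subset_span ⟨k, by simp, rfl⟩), ?_⟩
    have := (hb k).mul hc
    rwa [add_sub_cancel] at this

/-- The intersection in the inclusion-exclusion for `gradedPiece_insert`, computed by the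
regularity of `b k` modulo the ideal of `S`. -/
theorem gradedPiece_inf_map [DecidableEq κ] {S : Finset κ} {k : κ} (hk : k ∉ S)
    (h : HomogeneousKoszulSyzygies w b d (insert k S)) (γ : Γ) :
    gradedPiece w (Ideal.span (b '' S)) γ ⊓
        (weightedHomogeneousSubmodule ℂ w (γ - d k)).map (LinearMap.mulLeft ℂ (b k)) =
      (gradedPiece w (Ideal.span (b '' S)) (γ - d k)).map (LinearMap.mulLeft ℂ (b k)) := by
  apply le_antisymm
  · rintro _ ⟨⟨h1, -⟩, ⟨y, hy, rfl⟩⟩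
    exact ⟨y, ⟨h.mem_span_of_mul_mem hb hk hy h1, hy⟩, rfl⟩
  · rintro _ ⟨y, ⟨hy1, hy2⟩, rfl⟩
    refine ⟨⟨Ideal.mul_mem_left _ _ hy1, ?_⟩, ⟨y, hy2, rfl⟩⟩
    have := (hb k).mul hy2
    rwa [add_sub_cancel] at this

include hw

theorem ne_zero_of_syzygies [DecidableEq κ] (hd : ∀ k, 0 < deg (d k)) {S : Finset κ} {k : κ}
    (h : HomogeneousKoszulSyzygies w b d (insert k S)) : b k ≠ 0 := by
  intro h0
  have h1 := h.mono deg hw hb hd (S := insert k ∅) (by simp)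
  have h2 := h1.mem_span_of_mul_mem hb (Finset.notMem_empty k) (isWeightedHomogeneous_one ℂ w)
    (by simp [h0])
  simp at h2

/-- The recursion for the dimensions of the graded pieces, from multiplication by a regular
element. -/
theorem finrank_gradedPiece_insert [DecidableEq κ] (hd : ∀ k, 0 < deg (d k)) {S : Finset κ}
    {k : κ} (hk : k ∉ S) (h : HomogeneousKoszulSyzygies w b d (insert k S)) (γ : Γ) :
    Module.finrank ℂ (gradedPiece w (Ideal.span (b '' (insert k S : Finset κ))) γ) +
        Module.finrank ℂ (gradedPiece w (Ideal.span (b '' S)) (γ - d k)) =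
      Module.finrank ℂ (gradedPiece w (Ideal.span (b '' S)) γ) +
        Module.finrank ℂ (weightedHomogeneousSubmodule ℂ w (γ - d k)) := by
  have hinj : Function.Injective (LinearMap.mulLeft ℂ (b k)) :=
    mul_right_injective₀ (ne_zero_of_syzygies deg hw hb hd h)
  have := finite_weightedHomogeneousSubmodule deg hw (γ - d k)
  have := finite_weightedHomogeneousSubmodule deg hw γ
  have : FiniteDimensional ℂ (gradedPiece w (Ideal.span (b '' S)) γ) :=
    Submodule.finiteDimensional_of_le inf_le_right
  have h1 := Submodule.finrank_sup_add_finrank_inf_eq (gradedPiece w (Ideal.span (b '' S)) γ)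
    ((weightedHomogeneousSubmodule ℂ w (γ - d k)).map (LinearMap.mulLeft ℂ (b k)))
  rwa [gradedPiece_inf_map hb hk h, ← gradedPiece_insert hb S hk,
    (Submodule.equivMapOfInjective _ hinj _).finrank_eq.symm,
    (Submodule.equivMapOfInjective _ hinj _).finrank_eq.symm] at h1

/-- The dimensions of the graded pieces of the ideal of a homogeneous regular sequence depend only
on the degrees. -/
theorem finrank_gradedPiece_eq [DecidableEq κ] (hd : ∀ k, 0 < deg (d k))
    {b' : κ → MvPolynomial σ ℂ} (hb' : ∀ k, IsWeightedHomogeneous w (b' k) (d k)) (S : Finset κ)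
    (h : HomogeneousKoszulSyzygies w b d S) (h' : HomogeneousKoszulSyzygies w b' d S) (γ : Γ) :
    Module.finrank ℂ (gradedPiece w (Ideal.span (b '' S)) γ) =
      Module.finrank ℂ (gradedPiece w (Ideal.span (b' '' S)) γ) := by
  induction S using Finset.induction_on generalizing γ with
  | empty =>
    rw [Finset.coe_empty, Set.image_empty, Set.image_empty]
  | insert k S hk ih =>
    have e1 := finrank_gradedPiece_insert deg hw hb hd hk h γ
    have e2 := finrank_gradedPiece_insert deg hw hb' hd hk h' γ
    have hS := Finset.subset_insert k S
    rw [ih (h.mono deg hw hb hd hS) (h'.mono deg hw hb' hd hS),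
      ih (h.mono deg hw hb hd hS) (h'.mono deg hw hb' hd hS)] at e1
    omega

end Dimensions

section Glueing

theorem exists_linearEquiv_map_eq {E : Type*} [AddCommGroup E] [Module ℂ E]
    [FiniteDimensional ℂ E] (p q : Submodule ℂ E)
    (h : Module.finrank ℂ p = Module.finrank ℂ q) :
    ∃ e : E ≃ₗ[ℂ] E, p.map e.toLinearMap = q := by
  obtain ⟨p', hp⟩ := p.exists_isCompl
  obtain ⟨q', hq⟩ := q.exists_isCompl
  have h' : Module.finrank ℂ p' = Module.finrank ℂ q' := by
    have h1 := Submodule.finrank_add_eq_of_isCompl hp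
    have h2 := Submodule.finrank_add_eq_of_isCompl hq
    omega
  let e₁ := LinearEquiv.ofFinrankEq p q h
  let e₂ := LinearEquiv.ofFinrankEq p' q' h'
  let e : E ≃ₗ[ℂ] E := (Submodule.prodEquivOfIsCompl p p' hp).symm.trans
    ((e₁.prodCongr e₂).trans (Submodule.prodEquivOfIsCompl q q' hq))
  have he : ∀ x : p, e x = e₁ x := by
    intro x
    simp [e]
  refine ⟨e, le_antisymm ?_ ?_⟩
  · rintro _ ⟨x, hx, rfl⟩
    exact (he ⟨x, hx⟩).symm ▸ (e₁ ⟨x, hx⟩).2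
  · intro y hy
    refine ⟨e₁.symm ⟨y, hy⟩, (e₁.symm ⟨y, hy⟩).2, ?_⟩
    change e _ = y
    rw [he, LinearEquiv.apply_symm_apply]

variable {σ Γ : Type*}

theorem eq_sum_weightedHomogeneousComponent {Γ : Type*} [AddCommMonoid Γ] [DecidableEq Γ]
    (w : σ → Γ) (P : MvPolynomial σ ℂ) :
    P = ∑ γ ∈ P.support.image (Finsupp.weight w), weightedHomogeneousComponent w γ P := by
  conv_lhs => rw [← sum_weightedHomogeneousComponent w P]
  refine finsum_eq_sum_of_support_subset _ fun γ hγ => ?_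
  by_contra h
  exact hγ (weightedHomogeneousComponent_eq_zero_of_notMem w P γ (by simpa using h))

variable [AddCommGroup Γ] {w : σ → Γ}

/-- Homogeneous ideals whose graded pieces have the same finite dimensions correspond to each
other under a graded automorphism of the polynomial ring. -/
theorem exists_graded_linearEquiv (I J : Submodule ℂ (MvPolynomial σ ℂ))
    (hI : ∀ p ∈ I, ∀ γ, weightedHomogeneousComponent w γ p ∈ I)
    (hJ : ∀ p ∈ J, ∀ γ, weightedHomogeneousComponent w γ p ∈ J)
    (hfin : ∀ γ, FiniteDimensional ℂ (weightedHomogeneousSubmodule ℂ w γ))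
    (hdim : ∀ γ, Module.finrank ℂ (I ⊓ weightedHomogeneousSubmodule ℂ w γ : Submodule ℂ _) =
      Module.finrank ℂ (J ⊓ weightedHomogeneousSubmodule ℂ w γ : Submodule ℂ _)) :
    ∃ α : MvPolynomial σ ℂ ≃ₗ[ℂ] MvPolynomial σ ℂ,
      (∀ γ p, IsWeightedHomogeneous w p γ → IsWeightedHomogeneous w (α p) γ) ∧
      (∀ γ p, IsWeightedHomogeneous w p γ → IsWeightedHomogeneous w (α.symm p) γ) ∧
      I.map α.toLinearMap = J := by
  classical
  let := weightedGradedAlgebra ℂ w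
  let 𝒜 := weightedHomogeneousSubmodule ℂ w
  have hex : ∀ γ, ∃ e : 𝒜 γ ≃ₗ[ℂ] 𝒜 γ,
      (I.comap (𝒜 γ).subtype).map e.toLinearMap = J.comap (𝒜 γ).subtype := by
    intro γ
    have := hfin γ
    refine exists_linearEquiv_map_eq _ _ ?_
    have hc : ∀ K : Submodule ℂ (MvPolynomial σ ℂ),
        Module.finrank ℂ (K.comap (𝒜 γ).subtype) =
          Module.finrank ℂ (K ⊓ 𝒜 γ : Submodule ℂ (MvPolynomial σ ℂ)) := by
      intro K
      rw [inf_comm, ← Submodule.map_comap_subtype]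
      exact (Submodule.equivSubtypeMap _ _).finrank_eq
    rw [hc, hc, hdim γ]
  choose e he using hex
  let D := DirectSum.decomposeLinearEquiv 𝒜
  let α : MvPolynomial σ ℂ ≃ₗ[ℂ] MvPolynomial σ ℂ :=
    D.trans ((DFinsupp.mapRange.linearEquiv e).trans D.symm)
  have hα : ∀ γ (x : 𝒜 γ), α x = e γ x := by
    intro γ x
    have h1 : D x = DirectSum.lof ℂ Γ (fun γ => 𝒜 γ) γ x := DirectSum.decompose_coe 𝒜 x
    have h2 : DFinsupp.mapRange.linearEquiv e (DirectSum.lof ℂ Γ (fun γ => 𝒜 γ) γ x) =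
        DirectSum.lof ℂ Γ (fun γ => 𝒜 γ) γ (e γ x) := by
      exact DFinsupp.mapRange_single (hf := fun _ => map_zero _)
    change D.symm (DFinsupp.mapRange.linearEquiv e (D x)) = _
    rw [h1, h2]
    exact DirectSum.decompose_symm_of 𝒜 (e γ x)
  have hα' : ∀ γ (x : 𝒜 γ), α.symm x = (e γ).symm x := by
    intro γ x
    rw [LinearEquiv.symm_apply_eq, hα, LinearEquiv.apply_symm_apply]
  refine ⟨α, fun γ p hp => ?_, fun γ p hp => ?_, le_antisymm ?_ ?_⟩
  · rw [show α p = e γ ⟨p, hp⟩ from hα γ ⟨p, hp⟩]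
    exact (e γ ⟨p, hp⟩).2
  · rw [show α.symm p = (e γ).symm ⟨p, hp⟩ from hα' γ ⟨p, hp⟩]
    exact ((e γ).symm ⟨p, hp⟩).2
  · rintro _ ⟨p, hp, rfl⟩
    change α p ∈ J
    rw [eq_sum_weightedHomogeneousComponent w p, map_sum]
    refine Submodule.sum_mem _ fun γ _ => ?_
    rw [show α (weightedHomogeneousComponent w γ p) =
      e γ ⟨_, weightedHomogeneousComponent_mem w p γ⟩ from hα γ ⟨_, _⟩]
    have : e γ ⟨_, weightedHomogeneousComponent_mem w p γ⟩ ∈ J.comap (𝒜 γ).subtype := by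
      rw [← he γ]
      exact ⟨_, hI p hp γ, rfl⟩
    exact this
  · intro p hp
    refine ⟨α.symm p, ?_, LinearEquiv.apply_symm_apply _ _⟩
    change α.symm p ∈ I
    rw [eq_sum_weightedHomogeneousComponent w p, map_sum]
    refine Submodule.sum_mem _ fun γ _ => ?_
    rw [show α.symm (weightedHomogeneousComponent w γ p) =
      (e γ).symm ⟨_, weightedHomogeneousComponent_mem w p γ⟩ from hα' γ ⟨_, _⟩]
    have h1 : (⟨_, weightedHomogeneousComponent_mem w p γ⟩ : 𝒜 γ) ∈
        (I.comap (𝒜 γ).subtype).map (e γ).toLinearMap := by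
      rw [he γ]
      exact hJ p hp γ
    obtain ⟨y, hy, hyp⟩ := h1
    rw [← hyp]
    change (((e γ).symm (e γ y) : 𝒜 γ) : MvPolynomial σ ℂ) ∈ I
    rw [LinearEquiv.symm_apply_apply]
    exact hy

end Glueing

end FJRW

/-! ### Milnor rings as graded representations -/

namespace FJRW

open MvPolynomial Topology

section Monomials

variable {σ : Type} [Fintype σ]

theorem coeff_substTorus (h : σ → ℂˣ) (P : MvPolynomial σ ℂ) (a : σ →₀ ℕ) :
    coeff a (substTorus h P) = (∏ i, (h i : ℂ) ^ a i) * coeff a P := by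
  classical
  induction P using MvPolynomial.induction_on' with
  | add p r hp hr => rw [map_add, coeff_add, coeff_add, hp, hr, mul_add]
  | monomial b c =>
    have : substTorus h (monomial b c) = monomial b ((∏ i, (h i : ℂ) ^ b i) * c) := by
      rw [substTorus, aeval_monomial, Finsupp.prod_fintype _ _ (by simp)]
      simp only [mul_pow, Finset.prod_mul_distrib, ← C_pow]
      rw [← map_prod, algebraMap_eq, monomial_eq, Finsupp.prod_fintype _ _ (by simp), C_mul,
        mul_left_comm, mul_assoc]
    rw [this, coeff_monomial, coeff_monomial]
    split_ifs with hab
    · rw [hab]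
    · simp

/-- The monomials of `V` are invariant under every diagonal symmetry of `V`. -/
theorem prod_pow_eq_one {V : MvPolynomial σ ℂ} {h : σ → ℂˣ} (hV : h ∈ maxSymmetryGroup V)
    {a : σ →₀ ℕ} (ha : coeff a V ≠ 0) : ∏ i, h i ^ a i = 1 := by
  have h1 := coeff_substTorus h V a
  rw [substTorus_eq ⟨h, hV⟩] at h1
  have h2 := mul_eq_right₀ ha |>.1 h1.symm
  ext
  push_cast
  exact h2

/-- For an isolated critical point at the origin, each variable `x_i` has a companion `x_j` such
that some monomial `x_i ^ k * x_j` with `k ≥ 1` occurs in `V`. -/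
theorem exists_coeff_ne_zero {V : MvPolynomial σ ℂ} (hcrit : ∀ x, IsSingularPoint V x ↔ x = 0)
    (i : σ) : ∃ k j, 1 ≤ k ∧ coeff (Finsupp.single i k + Finsupp.single j 1) V ≠ 0 := by
  classical
  have h1 : ¬ IsSingularPoint V (Pi.single i 1) := by
    rw [hcrit]
    simp
  simp only [IsSingularPoint, not_forall] at h1
  obtain ⟨j, hj⟩ := h1
  rw [eval_eq'] at hj
  obtain ⟨a, ha, hne⟩ := Finset.exists_ne_zero_of_sum_ne_zero hj
  have hai : a = Finsupp.single i (a i) := by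
    ext l
    by_cases hl : l = i
    · subst hl; simp
    · rw [Finsupp.single_eq_of_ne hl]
      by_contra h0
      refine right_ne_zero_of_mul hne (Finset.prod_eq_zero (Finset.mem_univ l) ?_)
      simp [Pi.single_eq_of_ne hl, h0]
  have hc := mem_support_iff.1 ha
  rw [hai, coeff_pderiv] at hc
  refine ⟨a i, j, ?_, left_ne_zero_of_mul hc⟩
  by_contra h0
  have h0' : a i = 0 := by omega
  rw [hai, h0', Finsupp.single_zero] at ha
  have h2 := (hcrit 0).2 rfl j
  rw [eval_zero, constantCoeff_eq] at h2
  exact mem_support_iff.1 ha h2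

end Monomials

section PowersOfVariables

variable {σ : Type} [Fintype σ]

/-- By the Nullstellensatz, a common power of the variables lies in the Jacobian ideal. -/
theorem exists_X_pow_mem_jacobianIdeal {V : MvPolynomial σ ℂ}
    (hcrit : ∀ x, IsSingularPoint V x → x = 0) :
    ∃ n : ℕ, ∀ i, (X i : MvPolynomial σ ℂ) ^ n ∈ jacobianIdeal V := by
  have h1 : ∀ i, ∃ n : ℕ, (X i : MvPolynomial σ ℂ) ^ n ∈ jacobianIdeal V := by
    intro i
    change X i ∈ (jacobianIdeal V).radical
    rw [← vanishingIdeal_zeroLocus_eq_radical (K := ℂ)]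
    intro x hx
    have : x = 0 := hcrit x fun j => hx _ (Ideal.subset_span ⟨j, rfl⟩)
    simp [this]
  choose n hn using h1
  refine ⟨∑ i, n i, fun i => ?_⟩
  have hle : n i ≤ ∑ i, n i := Finset.single_le_sum (fun _ _ => Nat.zero_le _) (Finset.mem_univ i)
  rw [← Nat.sub_add_cancel hle, pow_add]
  exact Ideal.mul_mem_left _ _ (hn i)

/-- Powers of distinct variables form a regular sequence in every order. -/
theorem mem_span_of_X_pow_mul_mem (n : ℕ) (S : Finset σ) (j : σ) (hj : j ∉ S)
    (y : MvPolynomial σ ℂ)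
    (hy : X j ^ n * y ∈ Ideal.span ((fun i => (X i : MvPolynomial σ ℂ) ^ n) '' S)) :
    y ∈ Ideal.span ((fun i => (X i : MvPolynomial σ ℂ) ^ n) '' S) := by
  classical
  have himage : (fun i => (X i : MvPolynomial σ ℂ) ^ n) '' S =
      (fun a => monomial a (1 : ℂ)) '' ((fun i => Finsupp.single i n) '' (S : Set σ)) := by
    rw [Set.image_image]
    simp only [X_pow_eq_monomial]
  rw [himage, mem_ideal_span_monomial_image] at hy ⊢
  intro a ha
  obtain ⟨_, ⟨i, hi, rfl⟩, hle⟩ := hy (Finsupp.single j n + a) (by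
    rw [mem_support_iff, X_pow_eq_monomial, coeff_monomial_mul, one_mul]
    exact mem_support_iff.1 ha)
  refine ⟨_, ⟨i, hi, rfl⟩, ?_⟩
  have hij : i ≠ j := fun h => hj (h ▸ hi)
  rw [Finsupp.single_le_iff] at hle ⊢
  simpa [Finsupp.single_eq_of_ne hij] using hle

end PowersOfVariables

section Bigrading

variable {σ T : Type} [Fintype σ] (q : σ → ℚ) (t : T → σ → ℂˣ)

/-- The degree of the variables by weight and by character of a family of diagonal matrices: the
second component is the tuple of scalars by which the matrices act on `x_i`, written additively so
that the degrees form an additive group. -/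
def torusWeight (i : σ) : ℝ × (T → Additive ℂˣ) := ((q i : ℝ), fun τ => Additive.ofMul (t τ i))

variable {q t}

theorem weight_torusWeight (a : σ →₀ ℕ) : Finsupp.weight (torusWeight q t) a =
    (Finsupp.weight (fun i => (q i : ℝ)) a, fun τ => Additive.ofMul (∏ i, t τ i ^ a i)) := by
  simp only [Finsupp.weight_apply]
  rw [Finsupp.sum_fintype _ _ (by simp), Finsupp.sum_fintype _ _ (by simp)]
  ext1
  · simp [Prod.fst_sum, torusWeight]
  · funext τ
    simp [Prod.snd_sum, torusWeight, Finset.sum_apply, ofMul_prod]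

theorem isWeightedHomogeneous_of_torusWeight {P : MvPolynomial σ ℂ} {γ : ℝ × (T → Additive ℂˣ)}
    (hP : IsWeightedHomogeneous (torusWeight q t) P γ) :
    IsWeightedHomogeneous (fun i => (q i : ℝ)) P γ.1 := by
  intro a ha
  rw [← hP ha, weight_torusWeight]

theorem substTorus_of_torusWeight {P : MvPolynomial σ ℂ} {γ : ℝ × (T → Additive ℂˣ)}
    (hP : IsWeightedHomogeneous (torusWeight q t) P γ) (τ : T) :
    substTorus (t τ) P = ((γ.2 τ).toMul : ℂ) • P := by
  ext a
  rw [coeff_substTorus, coeff_smul, smul_eq_mul]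
  by_cases ha : coeff a P = 0
  · rw [ha, mul_zero, mul_zero]
  · rw [← hP ha, weight_torusWeight]
    simp

theorem weight_cast (a : σ →₀ ℕ) :
    Finsupp.weight (fun i => (q i : ℝ)) a = ((Finsupp.weight q a : ℚ) : ℝ) := by
  simp only [Finsupp.weight_apply]
  rw [Finsupp.sum_fintype _ _ (by simp), Finsupp.sum_fintype _ _ (by simp)]
  simp

theorem isWeightedHomogeneous_torusWeight {V : MvPolynomial σ ℂ}
    (hV : IsWeightedHomogeneous q V 1) (ht : ∀ τ, t τ ∈ maxSymmetryGroup V) :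
    IsWeightedHomogeneous (torusWeight q t) V (1, 0) := by
  intro a ha
  rw [weight_torusWeight, weight_cast, hV ha]
  ext1
  · simp
  · funext τ
    simp [prod_pow_eq_one (ht τ) ha]

/-- The derivatives of `V` have positive degree. -/
theorem weight_lt_one {V : MvPolynomial σ ℂ} (hq : ∀ i, 0 < q i)
    (hV : IsWeightedHomogeneous q V 1) (hcrit : ∀ x, IsSingularPoint V x ↔ x = 0) (i : σ) :
    q i < 1 := by
  obtain ⟨k, j, hk, hc⟩ := exists_coeff_ne_zero hcrit i
  have h1 := hV hc
  rw [map_add, Finsupp.weight_single, Finsupp.weight_single, one_smul, nsmul_eq_mul] at h1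
  have h2 : (1 : ℚ) ≤ k := by exact_mod_cast hk
  nlinarith [hq i, hq j]

theorem weightedHomogeneousComponent_mem_jacobianIdeal {Γ : Type*} [AddCommGroup Γ] {w : σ → Γ}
    {V : MvPolynomial σ ℂ} {d : σ → Γ} (hd : ∀ i, IsWeightedHomogeneous w (pderiv i V) (d i))
    {P : MvPolynomial σ ℂ} (hP : P ∈ jacobianIdeal V) (γ : Γ) :
    weightedHomogeneousComponent w γ P ∈ jacobianIdeal V := by
  obtain ⟨c, rfl⟩ := Ideal.mem_span_range_iff_exists_fun.1 hP
  rw [map_sum]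
  refine Ideal.sum_mem _ fun i _ => ?_
  rw [mul_comm, weightedHomogeneousComponent_mul (hd i)]
  exact Ideal.mul_mem_right _ _ (Ideal.subset_span ⟨i, rfl⟩)

/-- A linear map that preserves the degree by weight and characters preserves the degree by
weight. -/
theorem map_mem_weightedHomogeneousSubmodule (α : MvPolynomial σ ℂ →ₗ[ℂ] MvPolynomial σ ℂ)
    (hα : ∀ γ p, IsWeightedHomogeneous (torusWeight q t) p γ →
      IsWeightedHomogeneous (torusWeight q t) (α p) γ) {r : ℝ} {P : MvPolynomial σ ℂ}
    (hP : P ∈ weightedHomogeneousSubmodule ℂ (fun i => (q i : ℝ)) r) :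
    α P ∈ weightedHomogeneousSubmodule ℂ (fun i => (q i : ℝ)) r := by
  classical
  rw [eq_sum_weightedHomogeneousComponent (torusWeight q t) P, map_sum]
  refine Submodule.sum_mem _ fun γ hγ => ?_
  obtain ⟨a, ha, rfl⟩ := Finset.mem_image.1 hγ
  have h1 := isWeightedHomogeneous_of_torusWeight (hα _ _
    (weightedHomogeneousComponent_isWeightedHomogeneous
      (w := torusWeight q t) (n := Finsupp.weight (torusWeight q t) a) (φ := P)))
  have h2 : (Finsupp.weight (torusWeight q t) a).1 = r := by
    rw [weight_torusWeight]
    exact hP (mem_support_iff.1 ha)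
  rwa [h2] at h1

theorem map_substTorus (α : MvPolynomial σ ℂ →ₗ[ℂ] MvPolynomial σ ℂ)
    (hα : ∀ γ p, IsWeightedHomogeneous (torusWeight q t) p γ →
      IsWeightedHomogeneous (torusWeight q t) (α p) γ) (τ : T) (P : MvPolynomial σ ℂ) :
    α (substTorus (t τ) P) = substTorus (t τ) (α P) := by
  classical
  rw [eq_sum_weightedHomogeneousComponent (torusWeight q t) P]
  simp only [map_sum]
  refine Finset.sum_congr rfl fun γ _ => ?_
  have h1 := weightedHomogeneousComponent_isWeightedHomogeneous (w := torusWeight q t) (n := γ)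
    (φ := P)
  rw [substTorus_of_torusWeight h1, substTorus_of_torusWeight (hα _ _ h1), map_smul]

end Bigrading

section MilnorRings

variable {σ : Type} [Fintype σ] {q : σ → ℚ} {V V' : MvPolynomial σ ℂ}

/-- The Milnor rings of two polynomials with the same weights and common symmetries `S` have the
same dimensions in each degree and character, hence their top forms are isomorphic as graded
representations. -/
theorem exists_milnorForms_equiv (hq : ∀ i, 0 < q i) (hV : IsWeightedHomogeneous q V 1)
    (hV' : IsWeightedHomogeneous q V' 1) (hcrit : ∀ x, IsSingularPoint V x ↔ x = 0)
    (hcrit' : ∀ x, IsSingularPoint V' x ↔ x = 0) (S : Set (σ → ℂˣ))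
    (hS : ∀ h ∈ S, h ∈ maxSymmetryGroup V) (hS' : ∀ h ∈ S, h ∈ maxSymmetryGroup V') :
    ∃ E : MilnorForms V ≃ₗ[ℂ] MilnorForms V',
      (∀ (h : σ → ℂˣ) (_ : h ∈ S) (hh : h ∈ maxSymmetryGroup V) (hh' : h ∈ maxSymmetryGroup V') c,
        E (formPullback V ⟨h, hh⟩ c) = formPullback V' ⟨h, hh'⟩ (E c)) ∧
      ∀ p, (formsOfDegree q V p).map E.toLinearMap = formsOfDegree q V' p := by
  classical
  let w := torusWeight q (fun h : S => h.1)
  let d : σ → ℝ × (S → Additive ℂˣ) := fun i => (1, 0) - w i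
  let deg : ℝ × (S → Additive ℂˣ) →+ ℝ := AddMonoidHom.fst _ _
  have hw : ∀ i, 0 < deg (w i) := fun i => by
    change 0 < (q i : ℝ)
    exact_mod_cast hq i
  have hd : ∀ i, 0 < deg (d i) := fun i => by
    change (0 : ℝ) < 1 - (q i : ℝ)
    have : (q i : ℝ) < 1 := by exact_mod_cast weight_lt_one hq hV hcrit i
    linarith
  have hb : ∀ i, IsWeightedHomogeneous w (pderiv i V) (d i) := fun i =>
    (isWeightedHomogeneous_torusWeight hV fun τ : S => hS _ τ.2).pderiv (sub_add_cancel _ _)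
  have hb' : ∀ i, IsWeightedHomogeneous w (pderiv i V') (d i) := fun i =>
    (isWeightedHomogeneous_torusWeight hV' fun τ : S => hS' _ τ.2).pderiv (sub_add_cancel _ _)
  obtain ⟨n, hn⟩ := exists_X_pow_mem_jacobianIdeal fun x => (hcrit x).1
  obtain ⟨n', hn'⟩ := exists_X_pow_mem_jacobianIdeal fun x => (hcrit' x).1
  have hk := homogeneousKoszulSyzygies_univ hb (fun i => X i ^ n) (mem_span_of_X_pow_mul_mem n) hn
  have hk' := homogeneousKoszulSyzygies_univ hb' (fun i => X i ^ n')
    (mem_span_of_X_pow_mul_mem n') hn'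
  have hdim : ∀ γ, Module.finrank ℂ (gradedPiece w (jacobianIdeal V) γ) =
      Module.finrank ℂ (gradedPiece w (jacobianIdeal V') γ) := by
    intro γ
    have h1 := finrank_gradedPiece_eq deg hw hb hd hb' Finset.univ hk hk' γ
    rw [Finset.coe_univ, Set.image_univ, Set.image_univ] at h1
    exact h1
  obtain ⟨α, hα, hα', hmap⟩ := exists_graded_linearEquiv (w := w)
    ((jacobianIdeal V).restrictScalars ℂ) ((jacobianIdeal V').restrictScalars ℂ)
    (fun P hP γ => weightedHomogeneousComponent_mem_jacobianIdeal hb hP γ)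
    (fun P hP γ => weightedHomogeneousComponent_mem_jacobianIdeal hb' hP γ)
    (finite_weightedHomogeneousSubmodule deg hw) hdim
  refine ⟨Submodule.Quotient.equiv _ _ α hmap, ?_, fun p => ?_⟩
  · intro h hh1 hh hh' c
    obtain ⟨P, rfl⟩ := Submodule.mkQ_surjective _ c
    change Submodule.Quotient.mk (α (formPullbackPoly h P)) =
      Submodule.Quotient.mk (formPullbackPoly h (α P))
    have h2 : α (substTorus h P) = substTorus h (α P) :=
      map_substTorus α.toLinearMap hα (⟨h, hh1⟩ : S) P
    simp [formPullbackPoly, h2]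
  · rw [formsOfDegree, formsOfDegree, ← Submodule.map_comp]
    have hcomp : (Submodule.Quotient.equiv _ _ α hmap).toLinearMap ∘ₗ
        Submodule.mkQ ((jacobianIdeal V).restrictScalars ℂ) =
        Submodule.mkQ ((jacobianIdeal V').restrictScalars ℂ) ∘ₗ α.toLinearMap := rfl
    rw [hcomp, Submodule.map_comp]
    congr 1
    apply le_antisymm
    · rintro _ ⟨P, hP, rfl⟩
      exact map_mem_weightedHomogeneousSubmodule α.toLinearMap hα hP
    · intro P hP
      exact ⟨α.symm P, map_mem_weightedHomogeneousSubmodule α.symm.toLinearMap hα' hP,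
        α.apply_symm_apply P⟩

end MilnorRings

end FJRW

/-! ### Connecting two polynomials by a deformation -/

namespace FJRW

open MvPolynomial Topology

section FiniteExceptions

/-- In a pencil of linear maps one member of which is surjective, all but finitely many are. -/
theorem finite_not_surjective_add_smul {E A : Type*} [AddCommGroup E] [Module ℂ E]
    [AddCommGroup A] [Module ℂ A] [FiniteDimensional ℂ A] (T₀ T₁ : E →ₗ[ℂ] A)
    (h : Function.Surjective T₀) : {t : ℂ | ¬ Function.Surjective (T₀ + t • T₁)}.Finite := by
  obtain ⟨s, hs⟩ := T₀.exists_rightInverse_of_surjective (LinearMap.range_eq_top.2 h)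
  let B : Module.End ℂ A := T₁ ∘ₗ s
  refine ((Module.End.finite_hasEigenvalue B).image fun μ => -μ⁻¹).subset fun t ht => ?_
  have h1 : ¬ Function.Surjective (LinearMap.id + t • B : A →ₗ[ℂ] A) := by
    intro h2
    refine ht fun y => ?_
    obtain ⟨x, hx⟩ := h2 y
    refine ⟨s x, ?_⟩
    rw [← hx]
    have := LinearMap.congr_fun hs x
    simpa [B] using this
  rw [← LinearMap.injective_iff_surjective, ← LinearMap.ker_eq_bot, Submodule.eq_bot_iff] at h1
  push Not at h1
  obtain ⟨v, hv, hv0⟩ := h1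
  have hv' : v + t • B v = 0 := hv
  have ht0 : t ≠ 0 := by
    rintro rfl
    simp [hv0] at hv'
  refine ⟨-t⁻¹, Module.End.hasEigenvalue_of_hasEigenvector (x := v)
    ⟨Module.End.mem_eigenspace_iff.2 ?_, hv0⟩, by simp⟩
  have h3 : t • B v = -v := by rw [eq_neg_iff_add_eq_zero, add_comm]; exact hv'
  rw [neg_smul, ← smul_neg, ← h3, smul_smul, inv_mul_cancel₀ ht0, one_smul]

variable {σ : Type} [Fintype σ] {q : σ → ℚ}

/-- For an isolated critical point, the Jacobian ideal contains everything of large degree. -/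
theorem exists_mem_jacobianIdeal_of_lt (hq : ∀ i, 0 < q i) {V : MvPolynomial σ ℂ}
    (hcrit : ∀ x, IsSingularPoint V x → x = 0) :
    ∃ D : ℚ, ∀ γ, D < γ → ∀ p, IsWeightedHomogeneous q p γ → p ∈ jacobianIdeal V := by
  obtain ⟨n, hn⟩ := exists_X_pow_mem_jacobianIdeal hcrit
  refine ⟨∑ i, n * q i, fun γ hγ p hp => ?_⟩
  rw [p.as_sum]
  refine Ideal.sum_mem _ fun a ha => ?_
  have h1 := hp (mem_support_iff.1 ha)
  rw [Finsupp.weight_apply, Finsupp.sum_fintype _ _ (by simp)] at h1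
  rw [← h1] at hγ
  obtain ⟨i, -, hi⟩ := Finset.exists_lt_of_sum_lt hγ
  rw [nsmul_eq_mul] at hi
  have h2 : n ≤ a i := by
    have := lt_of_mul_lt_mul_right hi (hq i).le
    exact_mod_cast this.le
  have h3 : monomial a (coeff a p) =
      monomial (a - Finsupp.single i n) (coeff a p) * (X i : MvPolynomial σ ℂ) ^ n := by
    rw [X_pow_eq_monomial, monomial_mul, mul_one,
      tsub_add_cancel_of_le (Finsupp.single_le_iff.2 h2)]
  rw [h3]
  exact Ideal.mul_mem_left _ _ (hn i)

/-- The combinations of the partial derivatives of `P` with homogeneous coefficients, as a map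
into the polynomials of degree `γ`. -/
def jacobianCombination (q : σ → ℚ) {P : MvPolynomial σ ℂ} (hP : IsWeightedHomogeneous q P 1)
    (γ : ℚ) : (∀ i, weightedHomogeneousSubmodule ℂ q (γ - (1 - q i))) →ₗ[ℂ]
      weightedHomogeneousSubmodule ℂ q γ :=
  LinearMap.codRestrict _
    (∑ i, LinearMap.mulLeft ℂ (pderiv i P) ∘ₗ Submodule.subtype _ ∘ₗ LinearMap.proj i)
    (fun c => by
      rw [LinearMap.sum_apply]
      refine Submodule.sum_mem _ fun i _ => ?_
      have := (hP.pderiv (sub_add_cancel 1 (q i))).mul (c i).2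
      rwa [add_sub_cancel] at this)

theorem jacobianCombination_apply {P : MvPolynomial σ ℂ} (hP : IsWeightedHomogeneous q P 1)
    (γ : ℚ) (c) : (jacobianCombination q hP γ c : MvPolynomial σ ℂ) =
      ∑ i, pderiv i P * (c i : MvPolynomial σ ℂ) := by
  simp [jacobianCombination]

/-- On a line through a polynomial with an isolated critical point, all but finitely many
polynomials have an isolated critical point. -/
theorem finite_not_isolated (hq : ∀ i, 0 < q i) {V P : MvPolynomial σ ℂ}
    (hV : IsWeightedHomogeneous q V 1) (hP : IsWeightedHomogeneous q P 1)
    (hcrit : ∀ x, IsSingularPoint V x → x = 0) :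
    {t : ℂ | ¬ ∀ x, IsSingularPoint (V + t • P) x → x = 0}.Finite := by
  classical
  obtain ⟨D, hD⟩ := exists_mem_jacobianIdeal_of_lt hq hcrit
  have hk : ∀ j, ∃ k : ℕ, D < k * q j := fun j => by
    obtain ⟨k, hk⟩ := exists_nat_gt (D / q j)
    exact ⟨k, (div_lt_iff₀ (hq j)).1 hk⟩
  choose k hk using hk
  -- for the given polynomial the combinations of the derivatives exhaust the degree of `x_j ^ k`,
  -- and this persists for all but finitely many `t`
  have hfin : ∀ j, {t : ℂ | ¬ Function.Surjective (jacobianCombination q hV (k j * q j) +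
      t • jacobianCombination q hP (k j * q j))}.Finite := by
    intro j
    have := finite_weightedHomogeneousSubmodule (w := q) (Rat.castHom ℝ).toAddMonoidHom
      (fun i => by simpa using hq i) (k j * q j)
    refine finite_not_surjective_add_smul _ _ fun p => ?_
    have hp := hD _ (hk j) p.1 p.2
    rw [jacobianIdeal, ← Set.image_univ, ← Finset.coe_univ] at hp
    obtain ⟨c, hc, hpc⟩ := exists_homogeneous_of_mem_span
      (fun i => hV.pderiv (sub_add_cancel 1 (q i))) p.2 hp
    refine ⟨fun i => ⟨c i, hc i⟩, Subtype.ext ?_⟩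
    rw [jacobianCombination_apply, hpc]
  refine (Set.finite_iUnion hfin).subset fun t ht => ?_
  by_contra hgood
  simp only [Set.mem_iUnion, Set.mem_ofPred_eq, not_exists, not_not] at hgood
  refine ht fun x hx => funext fun j => ?_
  -- `x_j ^ k` is a combination of the partial derivatives, so `x_j` vanishes at critical points
  obtain ⟨c, hc⟩ := hgood j ⟨X j ^ k j, by
    have := (isWeightedHomogeneous_X ℂ q j).pow (k j)
    rwa [nsmul_eq_mul] at this⟩
  have h1 := congrArg (fun p : weightedHomogeneousSubmodule ℂ q (k j * q j) => eval x p.1) hc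
  have h2 : ∀ i, eval x (pderiv i V) + t * eval x (pderiv i P) = 0 := fun i => by
    simpa [smul_eval] using hx i
  simp only [LinearMap.add_apply, LinearMap.smul_apply, Submodule.coe_add, Submodule.coe_smul,
    jacobianCombination_apply, map_add, smul_eval, map_sum, map_mul, map_pow, eval_X,
    Finset.mul_sum, ← Finset.sum_add_distrib] at h1
  rw [Finset.sum_eq_zero fun i _ => by rw [← mul_assoc, ← add_mul, h2 i, zero_mul]] at h1
  exact (pow_eq_zero_iff (n := k j) (by
    intro h0
    simp [h0] at h1)).1 h1.symm

end FiniteExceptions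

section Deformation

variable {σ : Type} [Fintype σ] {q : σ → ℚ}

theorem add_smul_mem_maxSymmetryGroup {V P : MvPolynomial σ ℂ} {h : σ → ℂˣ}
    (hV : h ∈ maxSymmetryGroup V) (hP : h ∈ maxSymmetryGroup P) (t : ℂ) :
    h ∈ maxSymmetryGroup (V + t • P) := by
  intro x
  rw [map_add, map_add, smul_eval, smul_eval, hV x, hP x]

/-- The cohomology of the pair of `ℂ ^ N` and an upper set depends only on the weights, as a
representation of the common unitary diagonal symmetries. -/
theorem equivariantlyEquivalent_upperSet_of_isolated (hq : ∀ i, 0 < q i)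
    {V V' : MvPolynomial σ ℂ}
    (hV : IsWeightedHomogeneous q V 1) (hV' : IsWeightedHomogeneous q V' 1)
    (hcrit : ∀ x, IsSingularPoint V x → x = 0) (hcrit' : ∀ x, IsSingularPoint V' x → x = 0)
    {S : Set (σ → ℂˣ)} (hS : ∀ h ∈ S, ∀ i, ‖(h i : ℂ)‖ = 1)
    (hSV : ∀ h ∈ S, h ∈ maxSymmetryGroup V) (hSV' : ∀ h ∈ S, h ∈ maxSymmetryGroup V')
    {M M' : ℝ} (hM : 0 < M) (hM' : 0 < M') :
    EquivariantlyEquivalent S (upperSet V M) (upperSet V' M') := by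
  -- `V + t • P` joins `V` to `V'` in the complement of a finite set of `t`, which is connected
  let P := V' - V
  have hP : IsWeightedHomogeneous q P 1 :=
    (weightedHomogeneousSubmodule ℂ q 1).sub_mem hV' hV
  have hSP : ∀ h ∈ S, h ∈ maxSymmetryGroup P := fun h hh x => by
    rw [map_sub, map_sub, hSV h hh x, hSV' h hh x]
  have hVt : ∀ t : ℂ, IsWeightedHomogeneous q (V + t • P) 1 := fun t =>
    hV.add ((weightedHomogeneousSubmodule ℂ q 1).smul_mem t hP)
  have hSt : ∀ t : ℂ, ∀ h ∈ S, h ∈ maxSymmetryGroup (V + t • P) := fun t h hh =>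
    add_smul_mem_maxSymmetryGroup (hSV h hh) (hSP h hh) t
  have hstable : ∀ (t : ℂ) (m : ℝ), ∀ h ∈ S,
      Set.MapsTo (torusMap h) (upperSet (V + t • P) m) (upperSet (V + t • P) m) :=
    fun t m h hh => torusMap_mapsTo _ m ⟨h, hSt t h hh⟩
  let U : Set ℂ := {t | ¬ ∀ x, IsSingularPoint (V + t • P) x → x = 0}ᶜ
  have hU : IsPreconnected U :=
    ((finite_not_isolated hq hV hP hcrit).countable.isConnected_compl_of_one_lt_rank
      (by rw [Complex.rank_real_complex]; exact Nat.one_lt_ofNat)).isPreconnected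
  let R : ℂ → ℂ → Prop := fun s t => ∀ m > 0, ∀ m' > 0,
    EquivariantlyEquivalent S (upperSet (V + s • P) m) (upperSet (V + t • P) m')
  have hsymm : ∀ {s t}, R s t → R t s := fun h m hm m' hm' => (h m' hm' m hm).symm
  have key : R 0 1 := by
    refine hU.induction₂' R (fun t ht => ?_) (fun r s t _ _ _ h1 h2 m hm m' hm' =>
      (h1 m hm 1 one_pos).trans (h2 1 one_pos m' hm') (hstable s 1)) (x := 0) (y := 1) ?_ ?_
    · have ht' : ∀ x, IsSingularPoint (V + t • P) x → x = 0 := not_not.1 ht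
      obtain ⟨δ, hδ, m₀, hm₀, hR⟩ :=
        exists_equivariantlyEquivalent_perturbation hq (hVt t) hP ht' hS (hSt t)
      refine eventually_nhdsWithin_of_eventually_nhds ?_
      filter_upwards [Metric.ball_mem_nhds t hδ] with s hs
      have h1 := hR (s - t) (by simpa [dist_eq_norm] using hs)
      rw [add_assoc, ← add_smul, add_sub_cancel] at h1
      have h2 : R t s := fun m hm m' hm' =>
        ((equivariantlyEquivalent_upperSet hq S (hVt t) hm hm₀).trans h1
          (hstable t m₀)).trans (equivariantlyEquivalent_upperSet hq S (hVt s) hm₀ hm')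
          (hstable s m₀)
      exact ⟨h2, hsymm h2⟩
    · exact not_not.2 (by simpa using hcrit)
    · exact not_not.2 (by simpa [P] using hcrit')
  have h3 := key M hM M' hM'
  simpa [P] using h3

end Deformation

end FJRW

/-! ### Admissible polynomials and their sectors -/

namespace FJRW

open MvPolynomial Topology

section CriticalPoints

variable {σ : Type} [Fintype σ] {q : σ → ℚ} {W : MvPolynomial σ ℂ}

/-- By homogeneity, an isolated critical point at the origin is the only critical point. -/
theorem IsAdmissible.isSingularPoint_iff (hW : IsAdmissible q W) (x : σ → ℂ) :
    IsSingularPoint W x ↔ x = 0 := by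
  refine ⟨fun hx => ?_, fun h => h ▸ hW.nondegenerate.1⟩
  by_contra hx0
  have hlim : Filter.Tendsto (fun l : ℝ => weightedScale q l x) (𝓝[>] 0) (𝓝[≠] 0) := by
    refine tendsto_nhdsWithin_iff.2 ⟨?_, ?_⟩
    · refine Filter.Tendsto.mono_left ?_ nhdsWithin_le_nhds
      rw [tendsto_pi_nhds]
      intro i
      have hqi : (0 : ℝ) < q i := by exact_mod_cast hW.weight_pos i
      have h1 : Filter.Tendsto (fun l : ℝ => l ^ (q i : ℝ)) (𝓝 0) (𝓝 0) := by
        have := (Real.continuousAt_rpow_const 0 (q i : ℝ) (Or.inr hqi.le)).tendsto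
        rwa [Real.zero_rpow hqi.ne'] at this
      have h2 := ((Complex.continuous_ofReal.tendsto 0).comp h1).mul_const (x i)
      simpa [weightedScale_apply, Function.comp_def] using h2
    · filter_upwards [self_mem_nhdsWithin] with l hl h0
      have hl' : (0 : ℝ) < l := hl
      refine hx0 (funext fun i => ?_)
      have h1 := congrFun h0 i
      rw [weightedScale_apply] at h1
      refine (mul_eq_zero.1 h1).resolve_left ?_
      exact_mod_cast (Real.rpow_pos_of_pos hl' _).ne'
  obtain ⟨l, hl, hl0⟩ := ((hlim.eventually hW.nondegenerate.2).and self_mem_nhdsWithin).exists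
  refine hl fun i => ?_
  rw [eval_weightedScale (hW.quasihomogeneous.pderiv (sub_add_cancel 1 (q i))) hl0, hx i, mul_zero]

/-- The diagonal symmetries of an admissible polynomial are unitary: the monomials
`x_i ^ k * x_j` with `k ≥ 2` bound the modulus of each entry by that of another one. -/
theorem IsAdmissible.norm_eq_one (hW : IsAdmissible q W) {h : σ → ℂˣ}
    (hh : h ∈ maxSymmetryGroup W) (i : σ) : ‖(h i : ℂ)‖ = 1 := by
  classical
  let L : σ → ℝ := fun i => |Real.log ‖(h i : ℂ)‖|
  have hL : ∀ i, ∃ j, 2 * L i ≤ L j := by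
    intro i
    obtain ⟨k, j, hk, hc⟩ := exists_coeff_ne_zero hW.isSingularPoint_iff i
    have hk2 : 2 ≤ k := by
      rcases hk.lt_or_eq with h1 | rfl
      · exact h1
      · exact absurd (hW.no_quadratic i j) hc
    have h1 := prod_pow_eq_one hh hc
    rw [← Finsupp.prod_fintype (Finsupp.single i k + Finsupp.single j 1) (fun i a => h i ^ a)
      (by simp), Finsupp.prod_add_index' (by simp) (fun _ _ _ => pow_add _ _ _),
      Finsupp.prod_single_index (by simp), Finsupp.prod_single_index (by simp), pow_one] at h1
    have h2 := congrArg (fun z : ℂˣ => Real.log ‖(z : ℂ)‖) h1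
    simp only [Units.val_mul, Units.val_pow_eq_pow_val, norm_mul, norm_pow, Units.val_one,
      norm_one, Real.log_one] at h2
    rw [Real.log_mul (by simp) (by simp), Real.log_pow] at h2
    refine ⟨j, ?_⟩
    have h3 : L j = k * L i := by
      simp only [L]
      rw [eq_neg_of_add_eq_zero_right h2, abs_neg, abs_mul, Nat.abs_cast]
    rw [h3]
    exact mul_le_mul_of_nonneg_right (by exact_mod_cast hk2) (abs_nonneg _)
  obtain ⟨m, -, hm⟩ := Finset.exists_max_image Finset.univ L ⟨i, Finset.mem_univ i⟩
  obtain ⟨j, hj⟩ := hL m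
  have h1 := hm j (Finset.mem_univ j)
  have h2 := hm i (Finset.mem_univ i)
  have h3 : 0 ≤ L i := abs_nonneg _
  have h4 : Real.log ‖(h i : ℂ)‖ = 0 := abs_eq_zero.1 (by change L i = 0; linarith)
  exact Real.eq_one_of_pos_of_log_eq_zero (by simp) h4

end CriticalPoints

section Restriction

variable {σ : Type} [Fintype σ] {q : σ → ℚ} {W : MvPolynomial σ ℂ}

theorem pderiv_restrictToFixed (P : MvPolynomial σ ℂ) (g : σ → ℂˣ) (i : FixedIndex g) :
    pderiv i (restrictToFixed P g) = restrictToFixed (pderiv i.1 P) g := by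
  classical
  unfold restrictToFixed
  induction P using MvPolynomial.induction_on with
  | C a => simp
  | add p r hp hr => simp only [map_add, hp, hr]
  | mul_X p j hp =>
    rw [map_mul, Derivation.leibniz, Derivation.leibniz, hp, aeval_X, pderiv_X, map_add,
      smul_eq_mul, smul_eq_mul, smul_eq_mul, smul_eq_mul, map_mul, map_mul, aeval_X]
    congr 2
    by_cases hj : g j = 1
    · rw [dif_pos hj, pderiv_X]
      by_cases hij : j = i.1
      · subst hij; simp
      · rw [Pi.single_eq_of_ne' (fun h => hij h.symm), map_zero,
          Pi.single_eq_of_ne' (fun h => hij (congrArg Subtype.val h).symm)]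
    · have hij : i.1 ≠ j := fun h => hj (h ▸ i.2)
      rw [dif_neg hj, map_zero, Pi.single_eq_of_ne' hij, map_zero]

theorem isWeightedHomogeneous_restrictToFixed {d : ℚ} (hW : IsWeightedHomogeneous q W d)
    (g : σ → ℂˣ) :
    IsWeightedHomogeneous (fun i : FixedIndex g => q i.1) (restrictToFixed W g) d := by
  classical
  rw [restrictToFixed, aeval_def, eval₂_eq']
  refine Submodule.sum_mem (p := weightedHomogeneousSubmodule ℂ (fun i : FixedIndex g => q i.1) d)
    fun a ha => ?_
  rw [algebraMap_eq, ← smul_eq_C_mul]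
  refine Submodule.smul_mem _ _ ?_
  have h1 := hW (mem_support_iff.1 ha)
  rw [Finsupp.weight_apply, Finsupp.sum_fintype _ _ (by simp)] at h1
  rw [← h1]
  refine IsWeightedHomogeneous.prod _ _ _ fun i _ => IsWeightedHomogeneous.pow ?_ _
  split_ifs with hi
  · exact isWeightedHomogeneous_X ℂ (fun i : FixedIndex g => q i.1) ⟨i, hi⟩
  · exact isWeightedHomogeneous_zero ℂ _ _

theorem fixedInclusion_eq_zero_iff (g : σ → ℂˣ) (x : FixedIndex g → ℂ) :
    fixedInclusion g x = 0 ↔ x = 0 := by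
  constructor
  · intro h
    funext i
    have := congrFun h i.1
    simpa [fixedInclusion, i.2] using this
  · rintro rfl
    funext i
    simp [fixedInclusion]

/-- The restriction of an admissible polynomial to the fixed space of a symmetry has an isolated
critical point: the transversal derivatives vanish on the fixed space by invariance. -/
theorem IsAdmissible.isSingularPoint_restrictToFixed_iff (hW : IsAdmissible q W) {g : σ → ℂˣ}
    (hg : g ∈ maxSymmetryGroup W) (x : FixedIndex g → ℂ) :
    IsSingularPoint (restrictToFixed W g) x ↔ x = 0 := by
  rw [← fixedInclusion_eq_zero_iff, ← hW.isSingularPoint_iff]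
  refine ⟨fun hx i => ?_, fun hx i => ?_⟩
  · by_cases hi : g i = 1
    · have := hx ⟨i, hi⟩
      rwa [pderiv_restrictToFixed, eval_restrictToFixed] at this
    · have h1 := eval_pderiv_torusMap hg (fixedInclusion g x) i
      have h2 : torusMap g (fixedInclusion g x) = fixedInclusion g x :=
        (range_fixedInclusion g).subset ⟨x, rfl⟩
      rw [h2] at h1
      by_contra h0
      exact hi (Units.ext (mul_eq_right₀ h0 |>.1 h1))
  · rw [pderiv_restrictToFixed, eval_restrictToFixed]
    exact hx i.1

end Restriction

section Sectors

theorem map_comap_eq_comap_map {X X' Y Y' : Type*} [AddCommGroup X] [AddCommGroup X']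
    [AddCommGroup Y] [AddCommGroup Y'] [Module ℂ X] [Module ℂ X'] [Module ℂ Y] [Module ℂ Y']
    (f : X ≃ₗ[ℂ] X') (E : Y ≃ₗ[ℂ] Y') {a : X →ₗ[ℂ] Y} {a' : X' →ₗ[ℂ] Y'}
    (h : ∀ c, a' (f c) = E (a c)) (p : Submodule ℂ Y) :
    (p.comap a).map f.toLinearMap = (p.map E.toLinearMap).comap a' := by
  ext c
  obtain ⟨b, rfl⟩ := f.surjective c
  rw [Submodule.mem_comap, h]
  constructor
  · rintro ⟨x, hx, hxb⟩
    rw [← f.injective hxb]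
    exact ⟨_, hx, rfl⟩
  · rintro ⟨y, hy, hyb⟩
    have hy' : a b = y := (E.injective hyb).symm
    exact ⟨b, by change a b ∈ p; rwa [hy'], rfl⟩

variable {σ : Type} [Fintype σ] {q : σ → ℚ} {W W' : MvPolynomial σ ℂ} {G : Subgroup (σ → ℂˣ)}
  {M M' : ℝ} {g : σ → ℂˣ}

theorem exists_relCohomology_equiv (hW : IsAdmissible q W) (hW' : IsAdmissible q W')
    (hG : G ≤ maxSymmetryGroup W) (hG' : G ≤ maxSymmetryGroup W') (hM : 0 < M) (hM' : 0 < M')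
    (hg : g ∈ G) (n : ℕ) :
    ∃ e : RelCohomology (restrictToFixed W g) M n ≃ₗ[ℂ] RelCohomology (restrictToFixed W' g) M' n,
      ∀ (h : maxSymmetryGroup W) (h' : maxSymmetryGroup W'), h.1 ∈ G → h'.1 = h.1 → ∀ c,
        e (cohomologyPullback (restrictToFixed W g) M n (inducedSymmetry g h) c) =
          cohomologyPullback (restrictToFixed W' g) M' n (inducedSymmetry g h') (e c) := by
  have hS : ∀ h ∈ restrictTorus g '' (G : Set (σ → ℂˣ)), ∀ i, ‖(h i : ℂ)‖ = 1 := by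
    rintro _ ⟨h, hh, rfl⟩ i
    exact hW.norm_eq_one (hG hh) i.1
  obtain ⟨e, he⟩ := equivariantlyEquivalent_upperSet_of_isolated
    (fun i : FixedIndex g => hW.weight_pos i.1)
    (isWeightedHomogeneous_restrictToFixed hW.quasihomogeneous g)
    (isWeightedHomogeneous_restrictToFixed hW'.quasihomogeneous g)
    (fun x => (hW.isSingularPoint_restrictToFixed_iff (hG hg) x).1)
    (fun x => (hW'.isSingularPoint_restrictToFixed_iff (hG' hg) x).1) hS
    (by rintro _ ⟨h, hh, rfl⟩; exact restrictTorus_mem g (hG hh))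
    (by rintro _ ⟨h, hh, rfl⟩; exact restrictTorus_mem g (hG' hh)) hM hM' n
  refine ⟨e, ?_⟩
  rintro ⟨h, hh⟩ ⟨h', hh'⟩ hhG heq c
  obtain rfl : h' = h := heq
  exact he _ ⟨_, hhG, rfl⟩ _ _ c

theorem exists_sectorForms_equiv (hW : IsAdmissible q W) (hW' : IsAdmissible q W')
    (hG : G ≤ maxSymmetryGroup W) (hG' : G ≤ maxSymmetryGroup W') (hg : g ∈ G) :
    ∃ E : MilnorForms (restrictToFixed W g) ≃ₗ[ℂ] MilnorForms (restrictToFixed W' g),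
      (∀ (h : maxSymmetryGroup W) (h' : maxSymmetryGroup W'), h.1 ∈ G → h'.1 = h.1 → ∀ c,
        E (formPullback (restrictToFixed W g) (inducedSymmetry g h) c) =
          formPullback (restrictToFixed W' g) (inducedSymmetry g h') (E c)) ∧
      ∀ p, (sectorFormsOfDegree q W g p).map E.toLinearMap = sectorFormsOfDegree q W' g p := by
  obtain ⟨E, hE, hp⟩ := exists_milnorForms_equiv (fun i : FixedIndex g => hW.weight_pos i.1)
    (isWeightedHomogeneous_restrictToFixed hW.quasihomogeneous g)
    (isWeightedHomogeneous_restrictToFixed hW'.quasihomogeneous g)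
    (hW.isSingularPoint_restrictToFixed_iff (hG hg))
    (hW'.isSingularPoint_restrictToFixed_iff (hG' hg)) (restrictTorus g '' (G : Set (σ → ℂˣ)))
    (by rintro _ ⟨h, hh, rfl⟩; exact restrictTorus_mem g (hG hh))
    (by rintro _ ⟨h, hh, rfl⟩; exact restrictTorus_mem g (hG' hh))
  refine ⟨E, ?_, hp⟩
  rintro ⟨h, hh⟩ ⟨h', hh'⟩ hhG heq c
  obtain rfl : h' = h := heq
  exact hE _ ⟨_, hhG, rfl⟩ _ _ c

theorem map_sectorCohomology (hG : G ≤ maxSymmetryGroup W) (hG' : G ≤ maxSymmetryGroup W') {n : ℕ}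
    (e : RelCohomology (restrictToFixed W g) M n ≃ₗ[ℂ] RelCohomology (restrictToFixed W' g) M' n)
    (he : ∀ (h : maxSymmetryGroup W) (h' : maxSymmetryGroup W'), h.1 ∈ G → h'.1 = h.1 → ∀ c,
        e (cohomologyPullback (restrictToFixed W g) M n (inducedSymmetry g h) c) =
          cohomologyPullback (restrictToFixed W' g) M' n (inducedSymmetry g h') (e c)) :
    (sectorCohomology W G M g n).map e.toLinearMap = sectorCohomology W' G M' g n := by
  apply le_antisymm
  · rintro _ ⟨c, hc, rfl⟩ h' hh'
    have := he ⟨h'.1, hG hh'⟩ h' hh' rfl c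
    rw [hc ⟨h'.1, hG hh'⟩ hh'] at this
    exact this.symm
  · intro c hc
    refine ⟨e.symm c, fun h hh => ?_, e.apply_symm_apply c⟩
    apply e.injective
    rw [he h ⟨h.1, hG' hh⟩ hh rfl, LinearEquiv.apply_symm_apply, hc ⟨h.1, hG' hh⟩ hh]

theorem map_sectorForms (hG : G ≤ maxSymmetryGroup W) (hG' : G ≤ maxSymmetryGroup W')
    (E : MilnorForms (restrictToFixed W g) ≃ₗ[ℂ] MilnorForms (restrictToFixed W' g))
    (hE : ∀ (h : maxSymmetryGroup W) (h' : maxSymmetryGroup W'), h.1 ∈ G → h'.1 = h.1 → ∀ c,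
        E (formPullback (restrictToFixed W g) (inducedSymmetry g h) c) =
          formPullback (restrictToFixed W' g) (inducedSymmetry g h') (E c)) :
    (sectorForms W G g).map E.toLinearMap = sectorForms W' G g := by
  apply le_antisymm
  · rintro _ ⟨c, hc, rfl⟩ h' hh'
    have := hE ⟨h'.1, hG hh'⟩ h' hh' rfl c
    rw [hc ⟨h'.1, hG hh'⟩ hh'] at this
    exact this.symm
  · intro c hc
    refine ⟨E.symm c, fun h hh => ?_, E.apply_symm_apply c⟩
    apply E.injective
    rw [hE h ⟨h.1, hG' hh⟩ hh rfl, LinearEquiv.apply_symm_apply, hc ⟨h.1, hG' hh⟩ hh]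

/-- A Wall isomorphism for `W` gives one for `W'`, by composition with the isomorphisms of both
its sides. -/
theorem nonempty_wallIsomorphism (hW : IsAdmissible q W) (hW' : IsAdmissible q W')
    (hG : G ≤ maxSymmetryGroup W) (hG' : G ≤ maxSymmetryGroup W') (hM : 0 < M) (hM' : 0 < M')
    (hg : g ∈ G) (hw : Nonempty (WallIsomorphism W G M g)) :
    Nonempty (WallIsomorphism W' G M' g) := by
  obtain ⟨w⟩ := hw
  obtain ⟨e, he⟩ := exists_relCohomology_equiv hW' hW hG' hG hM' hM hg (fixedDim g)
  obtain ⟨E, hE, -⟩ := exists_sectorForms_equiv hW hW' hG hG' hg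
  refine ⟨⟨e.trans (w.toEquiv.trans E), fun h hh c => ?_⟩⟩
  simp only [LinearEquiv.trans_apply]
  rw [he h ⟨h.1, hG hh⟩ hh rfl, w.equivariant _ hh, hE ⟨h.1, hG hh⟩ h hh rfl]

/-- The middle cohomology of a sector depends only on the weights, with its Hodge pieces. In
contrast to the isomorphism from the deformation, the one from the Milnor rings respects the pieces,
so it is transported through the Wall isomorphisms. Their existence is not presupposed: it is a
property that `W` and `W'` share, and in its absence all the pieces are zero for both. -/
theorem exists_hodgePiece_equiv (hW : IsAdmissible q W) (hW' : IsAdmissible q W')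
    (hG : G ≤ maxSymmetryGroup W) (hG' : G ≤ maxSymmetryGroup W') (hM : 0 < M) (hM' : 0 < M')
    (hg : g ∈ G) :
    ∃ f : sectorCohomology W G M g (fixedDim g) ≃ₗ[ℂ] sectorCohomology W' G M' g (fixedDim g),
      ∀ p, (hodgePiece q W G M g p).map f.toLinearMap = hodgePiece q W' G M' g p := by
  by_cases hw : Nonempty (WallIsomorphism W G M g)
  · have hw' := nonempty_wallIsomorphism hW hW' hG hG' hM hM' hg hw
    obtain ⟨E, hE, hEp⟩ := exists_sectorForms_equiv hW hW' hG hG' hg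
    let w := Classical.choice hw
    let w' := Classical.choice hw'
    -- the isomorphism that the Milnor rings induce through the chosen Wall isomorphisms
    let e := w.toEquiv.trans (E.trans w'.toEquiv.symm)
    have hsymm : ∀ (h : maxSymmetryGroup W'), h.1 ∈ G → ∀ c,
        w'.toEquiv.symm (formPullback (restrictToFixed W' g) (inducedSymmetry g h) c) =
          cohomologyPullback (restrictToFixed W' g) M' (fixedDim g) (inducedSymmetry g h)
            (w'.toEquiv.symm c) := by
      intro h hh c
      rw [LinearEquiv.symm_apply_eq, w'.equivariant h hh, LinearEquiv.apply_symm_apply]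
    have hmap := map_sectorCohomology hG hG' e (fun h h' hh hhh c => by
      simp only [e, LinearEquiv.trans_apply]
      rw [w.equivariant h hh, hE h h' hh hhh, hsymm h' (hhh ▸ hh)])
    refine ⟨e.ofSubmodules _ _ hmap, fun p => ?_⟩
    rw [hodgePiece, hodgePiece, dif_pos hw, dif_pos hw']
    rw [← hEp p]
    exact map_comap_eq_comap_map _ E (fun c => w'.toEquiv.apply_symm_apply _) _
  · have hw' : ¬ Nonempty (WallIsomorphism W' G M' g) := fun h =>
      hw (nonempty_wallIsomorphism hW' hW hG' hG hM' hM hg h)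
    obtain ⟨e, he⟩ := exists_relCohomology_equiv hW hW' hG hG' hM hM' hg (fixedDim g)
    refine ⟨e.ofSubmodules _ _ (map_sectorCohomology hG hG' e he), fun p => ?_⟩
    rw [hodgePiece, hodgePiece, dif_neg hw, dif_neg hw', Submodule.map_bot]

theorem exists_sectorCohomology_equiv (hW : IsAdmissible q W) (hW' : IsAdmissible q W')
    (hG : G ≤ maxSymmetryGroup W) (hG' : G ≤ maxSymmetryGroup W') (hM : 0 < M) (hM' : 0 < M')
    (hg : g ∈ G) :
    ∃ f : ∀ n, sectorCohomology W G M g n ≃ₗ[ℂ] sectorCohomology W' G M' g n,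
      ∀ p, (hodgePiece q W G M g p).map (f (fixedDim g)).toLinearMap =
        hodgePiece q W' G M' g p := by
  obtain ⟨f₀, hf₀⟩ := exists_hodgePiece_equiv hW hW' hG hG' hM hM' hg
  choose e he using exists_relCohomology_equiv hW hW' hG hG' hM hM' hg
  refine ⟨Function.update
    (fun n => (e n).ofSubmodules _ _ (map_sectorCohomology hG hG' (e n) (he n)))
    (fixedDim g) f₀, ?_⟩
  rwa [Function.update_self]

end Sectors

end FJRW

end

theorem mainTheorem1 (N : ℕ) (q : Fin N → ℚ) (W W' : MvPolynomial (Fin N) ℂ)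
    (hW : FJRW.IsAdmissible q W) (hW' : FJRW.IsAdmissible q W')
    (G : Subgroup (Fin N → ℂˣ))
    (hG : FJRW.IsAdmissibleGroup q W G) (hG' : FJRW.IsAdmissibleGroup q W' G)
    (M M' : ℝ) (hM : 0 < M) (hM' : 0 < M') :
    (∃ f : FJRW.StateSpace W G M ≃ₗ[ℂ] FJRW.StateSpace W' G M',
      (∀ (g : G) (n : ℕ),
        (LinearMap.range (FJRW.sectorInclusion W G M g n)).map f.toLinearMap =
          LinearMap.range (FJRW.sectorInclusion W' G M' g n)) ∧
      ∀ a b : ℝ,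
        (FJRW.bigradedPiece q W G M a b).map f.toLinearMap =
          FJRW.bigradedPiece q W' G M' a b) ∧
    ∃ f : FJRW.FormStateSpace W G ≃ₗ[ℂ] FJRW.FormStateSpace W' G,
      (∀ g : G,
        (LinearMap.range (FJRW.formSectorInclusion W G g)).map f.toLinearMap =
          LinearMap.range (FJRW.formSectorInclusion W' G g)) ∧
      ∀ a b : ℝ,
        (FJRW.formBigradedPiece q W G a b).map f.toLinearMap =
          FJRW.formBigradedPiece q W' G a b := by
  constructor
  · choose F hF using fun g : G =>
      FJRW.exists_sectorCohomology_equiv hW hW' hG.le_max hG'.le_max hM hM' g.2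
    let f : FJRW.StateSpace W G M ≃ₗ[ℂ] FJRW.StateSpace W' G M' :=
      DFinsupp.mapRange.linearEquiv fun i : G × ℕ => F i.1 i.2
    have hf : ∀ (g : G) (n : ℕ), f.toLinearMap ∘ₗ FJRW.sectorInclusion W G M g n =
        FJRW.sectorInclusion W' G M' g n ∘ₗ (F g n).toLinearMap := fun g n =>
      LinearMap.ext fun c => DFinsupp.mapRange_single (hf := fun _ => map_zero _)
    refine ⟨f, fun g n => ?_, fun a b => ?_⟩
    · rw [← LinearMap.range_comp, hf, LinearEquiv.range_comp]
    · simp only [FJRW.bigradedPiece, Submodule.map_iSup, ← Submodule.map_comp, hf]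
      simp only [Submodule.map_comp, hF]
  · choose E hE hEp using fun g : G =>
      FJRW.exists_sectorForms_equiv hW hW' hG.le_max hG'.le_max g.2
    let F : ∀ g : G, FJRW.sectorForms W G g ≃ₗ[ℂ] FJRW.sectorForms W' G g := fun g =>
      (E g).ofSubmodules _ _ (FJRW.map_sectorForms hG.le_max hG'.le_max (E g) (hE g))
    let f : FJRW.FormStateSpace W G ≃ₗ[ℂ] FJRW.FormStateSpace W' G :=
      DFinsupp.mapRange.linearEquiv F
    have hf : ∀ g : G, f.toLinearMap ∘ₗ FJRW.formSectorInclusion W G g =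
        FJRW.formSectorInclusion W' G g ∘ₗ (F g).toLinearMap := fun g =>
      LinearMap.ext fun c => DFinsupp.mapRange_single (hf := fun _ => map_zero _)
    have hFp : ∀ (g : G) (p : ℝ),
        ((FJRW.sectorFormsOfDegree q W g p).comap (Submodule.subtype _)).map (F g).toLinearMap =
          (FJRW.sectorFormsOfDegree q W' g p).comap
            (Submodule.subtype (FJRW.sectorForms W' G g)) := by
      intro g p
      rw [← hEp g p]
      exact FJRW.map_comap_eq_comap_map (F g) (E g) (fun _ => rfl) _
    refine ⟨f, fun g => ?_, fun a b => ?_⟩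
    · rw [← LinearMap.range_comp, hf, LinearEquiv.range_comp]
    · simp only [FJRW.formBigradedPiece, Submodule.map_iSup, ← Submodule.map_comp, hf]
      simp only [Submodule.map_comp, hFp]
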